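/- Let $K$ be a compact (Hausdorff) Abelian group, written additively. For a subgroup $H\le K$ and a prime $p$ put $H[p]=\{x\in H: px=0\}$; let $\mathrm{Soc}(K)$ be the subgroup generated by all $K[p]$, $p$ prime; let $r_p(A)$ denote the $p$-rank $\dim_{\mathbb Z/p}A[p]$ of an Abelian group $A$; and for subgroups $G,H\le K$ put $\pi_{(H:G)}=\{p \text{ prime}: H[p]\not\le G\}$. A subgroup $G$ of a topological Abelian group $L$ is *locally essential* in $L$ if there is a neighbourhood $V$ of $0$ such that $G\cap S\neq\{0\}$ for every non-trivial closed subgroup $S$ of $L$ with $S\subseteq V$. It is *weakly essential* in $L$ if, for every prime $p$, $G\cap S\ne\{0\}$ for every infinite closed $p$-monothetic subgroup $S$ of $L$, where a topological group is *$p$-monothetic* if it has a dense cyclic subgroup and is either a cyclic $p$-group or topologically isomorphic to a subgroup of the $p$-adic integers $\mathbb Z_p$. A *$\delta$-subgroup* of a compact Abelian group $L$ is a closed totally disconnected subgroup $N$ such that $L/N$ is topologically isomorphic to a (possibly infinite, possibly trivial) power of the circle group $\mathbb T$. Finite-dimensional refers to the covering dimension. Let $G$ be a weakly essential subgroup of $K$.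 (a) If $G$ is locally essential in $K$, then $(*)$ for every prime $p$ the subgroup $G[p]$ of $K[p]$ is open, and there exists $n\in\mathbb N$ such that $r_p(K[p]/G[p])\le n$ for every prime $p$. (b) If $(*)$ holds and $\pi_{(K:G)}$ is finite, then $G$ is locally essential in $K$. (c) If $K_1:=\overline{\mathrm{Soc}(K)}$ is finite-dimensional, then the following conditions are equivalent: - (c$_1$) $G$ is locally essential in $K$; - (c$_2$) $(*)$ holds and $\pi_{(M:G)}$ is finite for every $\delta$-subgroup $M$ of $K$; - (c$_3$) $G\cap N$ is locally essential in $N$ for some $\delta$-subgroup $N$ of $K_1$; - (c$_3'$) $G\cap N$ is locally essential in $N$ for every $\delta$-subgroup $N$ of $K_1$. In particular, if $K$ is totally disconnected, then $G$ is locally essential in $K$ if and only if $\pi_{(K:G)}$ is finite and $G[p]$ is open in $K[p]$ for every prime $p$. -/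

import Mathlib

universe u

/-- `A` is monothetic: it has a dense cyclic subgroup. -/
def IsMonothetic (A : Type u) [AddCommGroup A] [TopologicalSpace A] : Prop :=
  ∃ a : A, Dense (AddSubgroup.zmultiples a : Set A)

/-- `A` is `p`-monothetic: it is monothetic, and either a cyclic `p`-group or topologically
isomorphic to a subgroup of the `p`-adic integers. -/
def IsPMonothetic (p : ℕ) [Fact p.Prime] (A : Type u) [AddCommGroup A] [TopologicalSpace A] :
    Prop :=
  IsMonothetic A ∧
    ((IsAddCyclic A ∧ ∃ k : ℕ, Nat.card A = p ^ k) ∨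
      ∃ H : AddSubgroup ℤ_[p], Nonempty (A ≃ₜ+ H))

/-- The finite open covers of `X` have finite open refinements in which every point lies in at
most `n + 1` members, i.e. the (Lebesgue) covering dimension satisfies `dim X ≤ n`. -/
def CoveringDimLE (X : Type u) [TopologicalSpace X] (n : ℕ) : Prop :=
  ∀ (k : ℕ) (U : Fin k → Set X), (∀ i, IsOpen (U i)) → (⋃ i, U i) = Set.univ →
    ∃ (m : ℕ) (V : Fin m → Set X), (∀ j, IsOpen (V j)) ∧ (⋃ j, V j) = Set.univ ∧
      (∀ j, ∃ i, V j ⊆ U i) ∧ ∀ x : X, {j | x ∈ V j}.ncard ≤ n + 1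

/-- `dim X < ∞` for the covering dimension. -/
def FiniteCoveringDim (X : Type u) [TopologicalSpace X] : Prop :=
  ∃ n : ℕ, CoveringDimLE X n

/-- `A` is a torus: topologically isomorphic to a (possibly infinite) power of the circle group.
Since `ι` embeds into `ι → 𝕋`, index types in the universe of `A` suffice. -/
def IsTorus (A : Type u) [AddCommGroup A] [TopologicalSpace A] : Prop :=
  ∃ ι : Type u, Nonempty (A ≃ₜ+ (ι → UnitAddCircle))

/-- The `p`-rank of an abelian group: the dimension of its `p`-torsion over `ℤ/p`. -/
noncomputable def pRank (p : ℕ) (A : Type u) [AddCommGroup A] : Cardinal.{u} :=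
  letI : Module (ZMod p) (AddSubgroup.torsionBy A (p : ℤ)) := AddSubgroup.torsionBy.zmodModule
  Module.rank (ZMod p) (AddSubgroup.torsionBy A (p : ℤ))

namespace AddSubgroup

variable {K : Type u} [AddCommGroup K]

/-- `H[p]`, as a subgroup of the ambient group `K`. -/
def pTorsion (H : AddSubgroup K) (p : ℕ) : AddSubgroup K :=
  H ⊓ torsionBy K (p : ℤ)

/-- `G[p]`, as a subgroup of `K[p]`. -/
def pTorsionIn (G : AddSubgroup K) (p : ℕ) : AddSubgroup (torsionBy K (p : ℤ)) :=
  (G.pTorsion p).addSubgroupOf (torsionBy K (p : ℤ))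

/-- The set `π_(H:G)` of all primes `p` such that `H[p]` is not contained in `G`. -/
def torsionPrimes (H G : AddSubgroup K) : Set ℕ :=
  {p | p.Prime ∧ ¬ H.pTorsion p ≤ G}

variable (K) in
/-- The socle of `K`, generated by all `K[p]`, `p` prime. -/
def socle : AddSubgroup K :=
  ⨆ p : Nat.Primes, torsionBy K ((p : ℕ) : ℤ)

variable [TopologicalSpace K]

/-- `G` is locally essential in `K`: for some neighbourhood `V` of `0`, it meets non-trivially
every non-trivial closed subgroup of `K` contained in `V`. -/
def IsLocallyEssential (G : AddSubgroup K) : Prop :=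
  ∃ V ∈ nhds (0 : K), ∀ S : AddSubgroup K, IsClosed (S : Set K) → S ≠ ⊥ → (S : Set K) ⊆ V →
    G ⊓ S ≠ ⊥

/-- `G` is weakly essential in `K`: for every prime `p` it meets non-trivially every infinite
closed `p`-monothetic subgroup of `K`. -/
def IsWeaklyEssential (G : AddSubgroup K) : Prop :=
  ∀ (p : ℕ) [Fact p.Prime] (S : AddSubgroup K), IsClosed (S : Set K) → (S : Set K).Infinite →
    IsPMonothetic p S → G ⊓ S ≠ ⊥

/-- `N` is a `δ`-subgroup of `K`: closed, totally disconnected, with `K ⧸ N` a torus. -/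
def IsDeltaSubgroup (N : AddSubgroup K) : Prop :=
  IsClosed (N : Set K) ∧ IsTotallyDisconnected (N : Set K) ∧ IsTorus (K ⧸ N)

/-- For every prime `p`, the subgroup `G[p]` of `K[p]` is open. -/
def PTorsionOpen (G : AddSubgroup K) : Prop :=
  ∀ p : ℕ, p.Prime → IsOpen (G.pTorsionIn p : Set (torsionBy K (p : ℤ)))

variable (K) in
/-- The closure of the socle of `K`. -/
def closedSocle [IsTopologicalAddGroup K] : AddSubgroup K :=
  (socle K).topologicalClosure

end AddSubgroup

/-! A non-trivial compact abelian group contains an element of prime order or, for some prime `p`, a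
closed copy of the `p`-adic integers (`exists_prime_order_or_padicInt`). A weakly essential `G`
meets every subgroup of the second kind, so only the first kind matters: `G` is locally essential
exactly when some neighbourhood `V` of `0` has the property that every cyclic subgroup of prime
order inside `V` lies in `G` (`IsLocallyEssential.exists_nhds`,
`isLocallyEssential_of_exists_nhds`).

The rest is read off from this criterion. For (a), `V` contains the common kernel of finitely many
characters, and on `K[p]` each of them takes at most `p` values. For (b), openness gives one
neighbourhood for each prime, and only finitely many need to be intersected. On a closed totally
disconnected subgroup, `V` contains an open subgroup of some finite index `d`, which contains all
`p`-torsion for `p > d`; so there are finitely many exceptional primes.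

For (c), elements of prime order lie in `K₁`, and a torus quotient of `K₁` is finite-dimensional,
hence has no small subgroups; so small cyclic subgroups of prime order already lie in the given
`δ`-subgroup `N`. Traces on `N` are controlled by `δ`-subgroups of `K`, because every closed totally
disconnected subgroup lies in one (`exists_isDeltaSubgroup_ge`).

Two classical facts carry the argument. Characters separate points, by Gelfand theory for
convolution operators; hence every homomorphism from the dual to the circle is an evaluation
(`exists_eval_eq`), and points of `K` are produced by extending homomorphisms into divisible groups.
And covering dimension bounds the number of independent characters, by Sperner's lemma and
Lebesgue's covering theorem. -/

set_option linter.unusedSectionVars false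

namespace CompactAbelian

open MeasureTheory Filter Topology ComplexConjugate

/-! ### Convolution of continuous functions -/

section Convolution

variable {K : Type u} [AddCommGroup K] [TopologicalSpace K] [IsTopologicalAddGroup K]
  [CompactSpace K] [MeasurableSpace K] [BorelSpace K]

theorem integrable_of_continuous_compactSpace (μ : Measure K) [IsFiniteMeasure μ] {f : K → ℂ}
    (hf : Continuous f) : Integrable f μ :=
  hf.integrable_of_hasCompactSupport (HasCompactSupport.of_compactSpace f)

variable (μ : Measure K) [μ.IsAddHaarMeasure]

/-- Integration against a finite measure, as a continuous functional on `C(K, ℂ)`. -/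
noncomputable def integralFunctional : C(K, ℂ) →L[ℂ] ℂ :=
  LinearMap.mkContinuous
    { toFun := fun f => ∫ x, f x ∂μ
      map_add' := fun f g => integral_add (integrable_of_continuous_compactSpace μ f.continuous)
        (integrable_of_continuous_compactSpace μ g.continuous)
      map_smul' := fun c f => integral_const_mul c f }
    (μ.real Set.univ) (fun f => by
      rw [mul_comm]
      exact norm_integral_le_of_norm_le_const (Eventually.of_forall f.norm_coe_le_norm))

/-- The convolution of continuous functions on a compact abelian group. -/
noncomputable def convolve (f g : C(K, ℂ)) : C(K, ℂ) where
  toFun x := ∫ y, f (x - y) * g y ∂μ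
  continuous_toFun := by
    -- Currying makes `x ↦ (y ↦ f (x - y) * g y)` continuous for the sup norm, and integration is a
    -- continuous functional.
    let F : C(K × K, ℂ) := ⟨fun z => f (z.1 - z.2) * g z.2, by fun_prop⟩
    exact (integralFunctional μ).continuous.comp F.curry.continuous

theorem convolve_apply (f g : C(K, ℂ)) (x : K) :
    convolve μ f g x = ∫ y, f (x - y) * g y ∂μ := rfl

theorem norm_convolve_le (f g : C(K, ℂ)) :
    ‖convolve μ f g‖ ≤ μ.real Set.univ * ‖f‖ * ‖g‖ := by
  refine (ContinuousMap.norm_le _ (by positivity)).2 fun x => ?_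
  rw [convolve_apply]
  calc _ ≤ ‖f‖ * ‖g‖ * μ.real Set.univ := by
        refine norm_integral_le_of_norm_le_const (Eventually.of_forall fun y => ?_)
        rw [norm_mul]
        exact mul_le_mul (f.norm_coe_le_norm _) (g.norm_coe_le_norm _) (norm_nonneg _)
          (norm_nonneg _)
    _ = _ := by ring

/-- Convolution as a bounded bilinear operator on `C(K, ℂ)`. -/
noncomputable def convolutionOp : C(K, ℂ) →L[ℂ] C(K, ℂ) →L[ℂ] C(K, ℂ) :=
  LinearMap.mkContinuous₂
    (LinearMap.mk₂ ℂ (convolve μ)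
      (fun f f' g => by
        ext x
        simp only [convolve_apply, ContinuousMap.add_apply, add_mul]
        exact integral_add (integrable_of_continuous_compactSpace μ (by fun_prop))
          (integrable_of_continuous_compactSpace μ (by fun_prop)))
      (fun c f g => by
        ext x
        simp only [convolve_apply, ContinuousMap.smul_apply, smul_eq_mul, mul_assoc]
        exact integral_const_mul c _)
      (fun f g g' => by
        ext x
        simp only [convolve_apply, ContinuousMap.add_apply, mul_add]
        exact integral_add (integrable_of_continuous_compactSpace μ (by fun_prop))
          (integrable_of_continuous_compactSpace μ (by fun_prop)))
      (fun c f g => by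
        ext x
        simp only [convolve_apply, ContinuousMap.smul_apply, smul_eq_mul, mul_left_comm _ c]
        exact integral_const_mul c _))
    (μ.real Set.univ) (norm_convolve_le μ)

theorem convolutionOp_apply (f g : C(K, ℂ)) : convolutionOp μ f g = convolve μ f g := rfl

theorem convolve_assoc (f g h : C(K, ℂ)) :
    convolve μ f (convolve μ g h) = convolve μ (convolve μ f g) h := by
  ext x
  simp only [convolve_apply, ← integral_const_mul, ← integral_mul_const]
  rw [integral_integral_swap_of_hasCompactSupport _ (HasCompactSupport.of_compactSpace _)]
  · congr 1
    ext z
    rw [← integral_sub_right_eq_self (fun y => f (x - z - y) * g y * h z) z]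
    congr 1
    ext y
    rw [show x - z - (y - z) = x - y by abel, mul_assoc]
  · simp only [Function.uncurry_def]
    fun_prop

/-- The reflection `x ↦ conj (f (-x))`. -/
noncomputable def reflect (f : C(K, ℂ)) : C(K, ℂ) where
  toFun x := conj (f (-x))
  continuous_toFun := by fun_prop

/-- The translate `x ↦ f (x + a)`. -/
noncomputable def translate (a : K) (f : C(K, ℂ)) : C(K, ℂ) where
  toFun x := f (x + a)
  continuous_toFun := by fun_prop

theorem continuous_translate (f : C(K, ℂ)) : Continuous fun a => translate a f := by
  let F : C(K × K, ℂ) := ⟨fun z => f (z.2 + z.1), by fun_prop⟩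
  exact F.curry.continuous

theorem translate_translate (a b : K) (f : C(K, ℂ)) :
    translate a (translate b f) = translate (a + b) f := by
  ext x
  exact congrArg f (add_assoc x a b)

/-- With commutativity, a translation can be moved from one factor to the other; this is what turns
a multiplicative functional into a character of `K`. -/
theorem translate_convolve (a : K) (f g : C(K, ℂ)) :
    convolve μ (translate a f) g = translate a (convolve μ f g) := by
  ext x
  simp only [convolve_apply, translate, ContinuousMap.coe_mk, sub_add_eq_add_sub]

variable [μ.IsNegInvariant]

theorem convolve_comm (f g : C(K, ℂ)) : convolve μ f g = convolve μ g f := by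
  ext x
  simp only [convolve_apply]
  rw [← integral_sub_left_eq_self _ μ x]
  simp [mul_comm]

theorem convolutionOp_mul (f g : C(K, ℂ)) :
    convolutionOp μ f * convolutionOp μ g = convolutionOp μ (convolve μ f g) :=
  ContinuousLinearMap.ext fun h => convolve_assoc μ f g h

theorem convolutionOp_commute (f g : C(K, ℂ)) :
    convolutionOp μ f * convolutionOp μ g = convolutionOp μ g * convolutionOp μ f := by
  rw [convolutionOp_mul, convolutionOp_mul, convolve_comm]

theorem reflect_convolve (f g : C(K, ℂ)) :
    reflect (convolve μ f g) = convolve μ (reflect f) (reflect g) := by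
  ext x
  simp only [reflect, convolve_apply, ContinuousMap.coe_mk, ← integral_conj, map_mul]
  rw [← integral_neg_eq_self]
  simp [neg_add_eq_sub]

theorem reflect_reflect (f : C(K, ℂ)) : reflect (reflect f) = f := by
  ext x
  simp [reflect]

end Convolution

end CompactAbelian

namespace CompactAbelian

open MeasureTheory Filter Topology ComplexConjugate

/-! ### Multiplicative functionals from Gelfand theory -/

section Gelfand

/-- In a commutative Banach algebra, an element whose powers do not decay superexponentially is
not annihilated by some character. -/
theorem exists_character_ne_zero {A : Type*} [NormedCommRing A] [NormedAlgebra ℂ A]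
    [CompleteSpace A] (a : A) {c r : ℝ} (hc : 0 < c) (hr : 0 < r)
    (h : ∀ k : ℕ, c * r ^ k ≤ ‖a ^ k‖) : ∃ φ : WeakDual.characterSpace ℂ A, φ a ≠ 0 := by
  by_contra! hφ
  -- The spectrum consists of the values of characters; a zero spectral radius will contradict
  -- Gelfand's formula.
  have hs : spectralRadius ℂ a = 0 := by
    rw [spectralRadius]
    refine le_antisymm (iSup₂_le fun z hz => ?_) bot_le
    obtain ⟨φ, rfl⟩ := WeakDual.CharacterSpace.mem_spectrum_iff_exists.1 hz
    simp [hφ φ]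
  have hlim := spectrum.pow_norm_pow_one_div_tendsto_nhds_spectralRadius a
  rw [hs] at hlim
  have hlim' : Tendsto (fun n : ℕ => ‖a ^ n‖ ^ (1 / n : ℝ)) atTop (𝓝 0) := by
    have := (ENNReal.tendsto_toReal ENNReal.zero_ne_top).comp hlim
    refine this.congr fun n => ?_
    simp only [Function.comp]
    exact ENNReal.toReal_ofReal (by positivity)
  have hc' : Tendsto (fun n : ℕ => c ^ (1 / n : ℝ) * r) atTop (𝓝 (1 * r)) := by
    refine Tendsto.mul_const r ?_
    have : Tendsto (fun n : ℕ => (1 / n : ℝ)) atTop (𝓝 0) := tendsto_one_div_atTop_nhds_zero_nat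
    simpa using (tendsto_const_nhds (x := c)).rpow this (Or.inl hc.ne')
  have := le_of_tendsto_of_tendsto hc' hlim' ((eventually_gt_atTop 0).mono fun n hn => by
    have hn' : (n : ℝ) ≠ 0 := by exact_mod_cast hn.ne'
    calc c ^ (1 / n : ℝ) * r = (c * r ^ n) ^ (1 / n : ℝ) := by
          rw [Real.mul_rpow hc.le (by positivity), ← Real.rpow_natCast r, ← Real.rpow_mul hr.le,
            mul_one_div_cancel hn', Real.rpow_one]
      _ ≤ _ := Real.rpow_le_rpow (by positivity) (h n) (by positivity))
  linarith

/-- Log-convexity of the norms of the iterates of a symmetric operator. -/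
theorem le_norm_iterate_of_symmetric {E : Type*} [NormedAddCommGroup E] [InnerProductSpace ℂ E]
    (v : ℕ → E) (hv : ∀ k l, inner ℂ (v (k + 1)) (v l) = inner ℂ (v k) (v (l + 1)))
    (h0 : v 0 ≠ 0) (h1 : v 1 ≠ 0) (k : ℕ) :
    ‖v 0‖ * (‖v 1‖ / ‖v 0‖) ^ k ≤ ‖v k‖ := by
  have p0 : 0 < ‖v 0‖ := norm_pos_iff.2 h0
  have p1 : 0 < ‖v 1‖ := norm_pos_iff.2 h1
  have key : ∀ k, 0 < ‖v k‖ ∧ ‖v 1‖ / ‖v 0‖ * ‖v k‖ ≤ ‖v (k + 1)‖ := by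
    intro k
    induction k with
    | zero => exact ⟨p0, by rw [div_mul_cancel₀ _ p0.ne']⟩
    | succ k ih =>
      obtain ⟨ihp, ih⟩ := ih
      have pos : 0 < ‖v (k + 1)‖ := lt_of_lt_of_le (by positivity) ih
      refine ⟨pos, ?_⟩
      -- Symmetry and Cauchy–Schwarz: the ratios of successive norms do not decrease.
      have h : ‖v (k + 1)‖ * ‖v (k + 1)‖ ≤ ‖v k‖ * ‖v (k + 2)‖ := by
        rw [← sq, ← inner_self_eq_norm_sq (𝕜 := ℂ), hv]
        exact (RCLike.re_le_norm _).trans (norm_inner_le_norm _ _)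
      have h2 : ‖v 1‖ / ‖v 0‖ * ‖v k‖ * ‖v (k + 1)‖ ≤ ‖v k‖ * ‖v (k + 2)‖ :=
        (mul_le_mul_of_nonneg_right ih pos.le).trans h
      nlinarith
  induction k with
  | zero => simp
  | succ k ih =>
    calc _ = ‖v 1‖ / ‖v 0‖ * (‖v 0‖ * (‖v 1‖ / ‖v 0‖) ^ k) := by ring
      _ ≤ ‖v 1‖ / ‖v 0‖ * ‖v k‖ := by gcongr
      _ ≤ _ := (key k).2

variable {K : Type u} [AddCommGroup K] [TopologicalSpace K] [IsTopologicalAddGroup K]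
  [CompactSpace K] [MeasurableSpace K] [BorelSpace K] (μ : Measure K) [μ.IsAddHaarMeasure]

theorem convolve_reflect_self_zero (u : C(K, ℂ)) :
    convolve μ (reflect u) u 0 = inner ℂ (ContinuousMap.toLp 2 μ ℂ u)
      (ContinuousMap.toLp 2 μ ℂ u) := by
  rw [ContinuousMap.inner_toLp, convolve_apply]
  simp [reflect, mul_comm]

theorem toLp_ne_zero {u : C(K, ℂ)} (hu : u ≠ 0) : ContinuousMap.toLp 2 μ ℂ u ≠ 0 := by
  intro h
  exact hu (ContinuousMap.toLp_injective (𝕜 := ℂ) (p := 2) μ (by rw [h, map_zero]))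

/-- The value at `0` is the squared `L²` norm of `u`, and Haar measure charges non-empty open sets.
-/
theorem convolve_reflect_self_ne_zero {u : C(K, ℂ)} (hu : u ≠ 0) :
    convolve μ (reflect u) u ≠ 0 := by
  intro h
  have := convolve_reflect_self_zero μ u
  rw [h, ContinuousMap.zero_apply] at this
  exact toLp_ne_zero μ hu (inner_self_eq_zero.1 this.symm)

variable [μ.IsNegInvariant]

/-- The kernel `h (x - y)` is Hermitian, so Fubini gives a symmetric operator for the `L²` product.
-/
theorem inner_convolve_of_reflect_eq {h : C(K, ℂ)} (hh : reflect h = h) (a b : C(K, ℂ)) :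
    inner ℂ (ContinuousMap.toLp 2 μ ℂ (convolve μ h a)) (ContinuousMap.toLp 2 μ ℂ b) =
      inner ℂ (ContinuousMap.toLp 2 μ ℂ a) (ContinuousMap.toLp 2 μ ℂ (convolve μ h b)) := by
  have h' : ∀ x, conj (h x) = h (-x) := fun x => by
    conv_rhs => rw [← hh]
    simp [reflect]
  rw [ContinuousMap.inner_toLp, ContinuousMap.inner_toLp]
  simp only [convolve_apply, ← integral_conj, ← integral_const_mul, ← integral_mul_const]
  rw [integral_integral_swap_of_hasCompactSupport _ (HasCompactSupport.of_compactSpace _)]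
  · congr 1
    ext y
    congr 1
    ext x
    simp only [map_mul, h', neg_sub]
    ring
  · simp only [Function.uncurry_def]
    fun_prop

/-- A function which is fixed by reflection and does not vanish is detected by some continuous
functional that is multiplicative for the convolution. -/
theorem exists_multiplicative_functional_ne_zero {h : C(K, ℂ)} (hh : reflect h = h) (h0 : h ≠ 0) :
    ∃ Φ : C(K, ℂ) →L[ℂ] ℂ, (∀ f g, Φ (convolve μ f g) = Φ f * Φ g) ∧ Φ h ≠ 0 := by
  let S : Set (C(K, ℂ) →L[ℂ] C(K, ℂ)) := Set.range (convolutionOp μ)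
  let B := (Algebra.adjoin ℂ S).topologicalClosure
  have hcomm : ∀ x y : Algebra.adjoin ℂ S, x * y = y * x := by
    have := Algebra.isMulCommutative_adjoin ℂ (s := S) (by
      rintro _ ⟨f, rfl⟩ _ ⟨g, rfl⟩
      exact convolutionOp_commute μ f g)
    exact fun x y => mul_comm' x y
  let _ : NormedCommRing B :=
    { (inferInstance : NormedRing B) with
      mul_comm := ((Algebra.adjoin ℂ S).commRingTopologicalClosure hcomm).mul_comm }
  have : CompleteSpace B :=
    (Subalgebra.isClosed_topologicalClosure _).completeSpace_coe
  have hmem : ∀ f, convolutionOp μ f ∈ B := fun f =>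
    Subalgebra.le_topologicalClosure _ (Algebra.subset_adjoin ⟨f, rfl⟩)
  let L : C(K, ℂ) →L[ℂ] B := (convolutionOp μ).codRestrict (Subalgebra.toSubmodule B) hmem
  have hL : ∀ f, (L f : C(K, ℂ) →L[ℂ] C(K, ℂ)) = convolutionOp μ f := fun f => rfl
  -- The `L²` classes of the convolution powers of `h`. Their geometric growth is transferred to the
  -- operator norms of the powers of `L h`.
  let v : ℕ → Lp ℂ 2 μ := fun k => ContinuousMap.toLp 2 μ ℂ ((convolutionOp μ h ^ k) h)
  have hv0 : v 0 ≠ 0 := toLp_ne_zero μ h0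
  have hv1 : v 1 ≠ 0 := by
    refine toLp_ne_zero μ ?_
    rw [pow_one, convolutionOp_apply]
    conv => enter [1, 2]; rw [← hh]
    exact convolve_reflect_self_ne_zero μ h0
  have hv : ∀ k l, inner ℂ (v (k + 1)) (v l) = inner ℂ (v k) (v (l + 1)) := by
    intro k l
    simp only [v, pow_succ', mul_apply_eq_comp, convolutionOp_apply]
    exact inner_convolve_of_reflect_eq μ hh _ _
  have hgrow := le_norm_iterate_of_symmetric v hv hv0 hv1
  have hC : 0 < ‖(ContinuousMap.toLp 2 μ ℂ : C(K, ℂ) →L[ℂ] Lp ℂ 2 μ)‖ * ‖h‖ :=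
    (norm_pos_iff.2 hv0).trans_le (ContinuousLinearMap.le_opNorm _ _)
  obtain ⟨φ, hφ⟩ := exists_character_ne_zero (L h)
    (c := ‖v 0‖ / (‖(ContinuousMap.toLp 2 μ ℂ : C(K, ℂ) →L[ℂ] Lp ℂ 2 μ)‖ * ‖h‖))
    (r := ‖v 1‖ / ‖v 0‖) (div_pos (norm_pos_iff.2 hv0) hC)
    (div_pos (norm_pos_iff.2 hv1) (norm_pos_iff.2 hv0)) (fun k => by
      rw [div_mul_eq_mul_div, div_le_iff₀ hC]
      refine (hgrow k).trans ?_
      refine (ContinuousLinearMap.le_opNorm _ _).trans ?_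
      have : ‖(convolutionOp μ h ^ k) h‖ ≤ ‖L h ^ k‖ * ‖h‖ := ContinuousLinearMap.le_opNorm _ _
      calc _ ≤ ‖(ContinuousMap.toLp 2 μ ℂ : C(K, ℂ) →L[ℂ] Lp ℂ 2 μ)‖ * (‖L h ^ k‖ * ‖h‖) := by
            gcongr
        _ = _ := by ring)
  refine ⟨(WeakDual.CharacterSpace.toCLM φ).comp L, fun f g => ?_, hφ⟩
  have : L (convolve μ f g) = L f * L g := Subtype.ext (convolutionOp_mul μ f g).symm
  change φ (L _) = φ (L f) * φ (L g)
  rw [this, map_mul]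

end Gelfand

end CompactAbelian

namespace CompactAbelian

open MeasureTheory Filter Topology ComplexConjugate

/-! ### Characters separate points -/

section Separation

variable {K : Type u} [AddCommGroup K] [TopologicalSpace K] [IsTopologicalAddGroup K]
  [CompactSpace K]

/-- The powers of `χ x` are values of `χ`, hence bounded by compactness; so `‖χ‖ ≤ 1`, and the same
bound at `-x` forces equality. -/
theorem continuous_hom_norm_eq_one {χ : K → ℂ} (hc : Continuous χ) (h0 : χ 0 = 1)
    (ha : ∀ x y, χ (x + y) = χ x * χ y) (x : K) : ‖χ x‖ = 1 := by
  have hle : ∀ x, ‖χ x‖ ≤ 1 := by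
    intro x
    by_contra! hx
    obtain ⟨C, hC⟩ := (isCompact_range hc).isBounded.exists_norm_le
    obtain ⟨n, hn⟩ := pow_unbounded_of_one_lt C hx
    have hpow : ∀ n : ℕ, χ (n • x) = χ x ^ n := by
      intro n
      induction n with
      | zero => simp [h0]
      | succ n ih => rw [succ_nsmul, ha, ih, pow_succ]
    have := hC _ ⟨n • x, rfl⟩
    rw [hpow, norm_pow] at this
    linarith
  have h := ha x (-x)
  rw [add_neg_cancel, h0] at h
  have h' := congrArg norm h
  rw [norm_one, norm_mul] at h'
  nlinarith [hle x, hle (-x), norm_nonneg (χ x), norm_nonneg (χ (-x))]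

/-- A continuous multiplicative function with values in the complex numbers gives a character. -/
theorem exists_character_of_multiplicative {χ : K → ℂ} (hc : Continuous χ) (h0 : χ 0 = 1)
    (ha : ∀ x y, χ (x + y) = χ x * χ y) :
    ∃ ψ : K →ₜ+ UnitAddCircle, ∀ x, (AddCircle.toCircle (ψ x) : ℂ) = χ x := by
  let e := AddCircle.homeomorphCircle (T := (1 : ℝ)) one_ne_zero
  let c : K → Circle := fun x => ⟨χ x, by
    rw [← SetLike.mem_coe, Submonoid.coe_unitSphere, mem_sphere_zero_iff_norm]
    exact continuous_hom_norm_eq_one hc h0 ha x⟩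
  have hcc : Continuous c := by
    exact Continuous.subtype_mk hc _
  have he : ∀ z, AddCircle.toCircle (e.symm z) = z := fun z => by
    rw [← AddCircle.homeomorphCircle_apply one_ne_zero]
    exact e.apply_symm_apply z
  refine ⟨ContinuousAddMonoidHom.mk (AddMonoidHom.mk' (fun x => e.symm (c x)) fun x y => ?_)
    (e.symm.continuous.comp hcc), fun x => ?_⟩
  · refine AddCircle.injective_toCircle one_ne_zero ?_
    rw [AddCircle.toCircle_add, he, he, he]
    exact Subtype.ext (ha x y)
  · change (AddCircle.toCircle (e.symm (c x)) : ℂ) = χ x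
    rw [he]

variable [T2Space K]

/-- The characters of a compact abelian group separate points. -/
theorem exists_character_ne_zero_of_ne_zero {x : K} (hx : x ≠ 0) :
    ∃ ψ : K →ₜ+ UnitAddCircle, ψ x ≠ 0 := by
  borelize K
  let μ : Measure K := Measure.addHaar
  obtain ⟨f₀, hf₀, hf₁, -⟩ := exists_continuous_zero_one_of_isClosed (X := K)
    (isClosed_singleton (x := 0)) (isClosed_singleton (x := x)) (by simpa using hx.symm)
  let f : C(K, ℂ) := ⟨fun y => (f₀ y : ℂ), by fun_prop⟩
  -- A functional on which translation by `x` acts trivially kills `w`; so `Φ w ≠ 0` will force the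
  -- resulting character to be non-trivial at `x`.
  let w : C(K, ℂ) := translate x f - f
  have hw : w ≠ 0 := by
    intro h
    have h1 := congrArg (fun g : C(K, ℂ) => g 0) h
    have h2 : f₀ 0 = 0 := hf₀ rfl
    have h3 : f₀ x = 1 := hf₁ rfl
    simp [w, translate, f, h2, h3] at h1
  obtain ⟨Φ, hmul, hΦ⟩ := exists_multiplicative_functional_ne_zero μ
    (h := convolve μ (reflect w) w)
    (by rw [reflect_convolve, reflect_reflect, convolve_comm])
    (convolve_reflect_self_ne_zero μ hw)
  rw [hmul] at hΦ
  have hw' : Φ w ≠ 0 := right_ne_zero_of_mul hΦ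
  have htr : ∀ a g₁ g₂, Φ (translate a g₁) * Φ g₂ = Φ g₁ * Φ (translate a g₂) := by
    intro a g₁ g₂
    rw [← hmul, ← hmul, translate_convolve, convolve_comm μ g₁ (translate a g₂),
      translate_convolve, convolve_comm μ g₁]
  -- Translation by `a` acts on `Φ` through a scalar, which is the character sought.
  let χ : K → ℂ := fun a => Φ (translate a w) / Φ w
  have hχ : ∀ a g, Φ (translate a g) = χ a * Φ g := by
    intro a g
    simp only [χ]
    rw [div_mul_eq_mul_div, eq_div_iff hw', htr, mul_comm]
  have hzero : ∀ g : C(K, ℂ), translate 0 g = g := fun g => by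
    ext y
    simp [translate]
  obtain ⟨ψ, hψ⟩ := exists_character_of_multiplicative (χ := χ)
    ((Φ.continuous.comp (continuous_translate w)).div_const _)
    (by simp only [χ]; rw [hzero, div_self hw'])
    (fun a b => by
      refine mul_right_cancel₀ hw' ?_
      rw [← hχ, ← translate_translate, hχ, hχ, mul_assoc])
  refine ⟨ψ, fun h => hw' ?_⟩
  have h1 : χ x = 1 := by rw [← hψ, h]; simp
  simp only [w, map_sub, hχ, h1, one_mul, sub_self]

end Separation

/-! ### Characters of the circle -/

section Circle

/-- An integral of a non-trivial character vanishes. -/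
theorem integral_character_eq_zero (ψ : UnitAddCircle →ₜ+ UnitAddCircle) (hψ : ψ ≠ 0) :
    ∫ t : UnitAddCircle, (AddCircle.toCircle (ψ t) : ℂ) ∂AddCircle.haarAddCircle = 0 := by
  obtain ⟨a, ha⟩ : ∃ a, ψ a ≠ 0 := by
    by_contra! h
    exact hψ (ContinuousAddMonoidHom.ext h)
  have hne : (AddCircle.toCircle (ψ a) : ℂ) ≠ 1 := by
    intro h
    refine ha (AddCircle.injective_toCircle one_ne_zero ?_)
    rw [AddCircle.toCircle_zero]
    exact Subtype.ext h
  have h := integral_add_left_eq_self (μ := AddCircle.haarAddCircle)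
    (fun t : UnitAddCircle => (AddCircle.toCircle (ψ t) : ℂ)) a
  simp only [map_add, AddCircle.toCircle_add, Circle.coe_mul] at h
  rw [integral_const_mul] at h
  have h' : ((AddCircle.toCircle (ψ a) : ℂ) - 1) *
      ∫ t : UnitAddCircle, (AddCircle.toCircle (ψ t) : ℂ) ∂AddCircle.haarAddCircle = 0 := by
    rw [sub_mul, h, one_mul, sub_self]
  exact (mul_eq_zero.1 h').resolve_left (sub_ne_zero.2 hne)

/-- The characters of the circle group are the multiplications by integers. -/
theorem exists_int_of_circle_character (ψ : UnitAddCircle →ₜ+ UnitAddCircle) :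
    ∃ n : ℤ, ∀ t, ψ t = n • t := by
  -- If `ψ` is no multiplication by an integer, then all Fourier coefficients of the unimodular
  -- function `f` vanish.
  by_contra! hn
  let f : C(UnitAddCircle, ℂ) := ⟨fun t => (AddCircle.toCircle (ψ t) : ℂ), by fun_prop⟩
  have hcoeff : ∀ n : ℤ, fourierCoeff f n = 0 := by
    intro n
    let ψ' : UnitAddCircle →ₜ+ UnitAddCircle :=
      ContinuousAddMonoidHom.mk (AddMonoidHom.mk' (fun t => ψ t - n • t) fun x y => by
        rw [map_add, smul_add]; abel) (by
          exact ψ.continuous_toFun.sub (continuous_zsmul n))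
    have h := integral_character_eq_zero ψ' (by
      obtain ⟨t, ht⟩ := hn n
      intro h
      apply ht
      have : ψ t - n • t = 0 := congrArg (fun g : UnitAddCircle →ₜ+ UnitAddCircle => g t) h
      exact sub_eq_zero.1 this)
    rw [← h, fourierCoeff]
    congr 1
    ext t
    have : ψ' t = -n • t + ψ t := by
      change ψ t - n • t = _
      rw [neg_smul]; abel
    rw [this, AddCircle.toCircle_add, Circle.coe_mul]
    simp [f, fourier_apply]
  have hf : f = 0 := by
    have h0 : fourierCoeff (f : UnitAddCircle → ℂ) = 0 := funext hcoeff
    have hsum := hasSum_fourier_series_of_summable (f := f) (by rw [h0]; exact summable_zero)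
    rw [h0] at hsum
    refine hsum.unique ?_
    convert (hasSum_zero : HasSum (fun _ : ℤ => (0 : C(UnitAddCircle, ℂ))) 0) using 2 with i
    exact zero_smul ℂ (fourier i : C(UnitAddCircle, ℂ))
  have := congrArg (fun g : C(UnitAddCircle, ℂ) => g 0) hf
  simp [f] at this

end Circle

/-! ### Evaluation on the character group -/

section Duality

/-- A closed subgroup of a finite-dimensional torus is the annihilator of a set of integral
vectors. -/
theorem exists_int_annihilator {ι : Type*} [Finite ι] (H : AddSubgroup (ι → UnitAddCircle))
    (hH : IsClosed (H : Set (ι → UnitAddCircle))) {y : ι → UnitAddCircle} (hy : y ∉ H) :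
    ∃ m : ι → ℤ, (∀ h ∈ H, ∑ᶠ i, m i • h i = 0) ∧ ∑ᶠ i, m i • y i ≠ 0 := by
  classical
  have := Fintype.ofFinite ι
  have : IsClosed (H : Set (ι → UnitAddCircle)) := hH
  have hy' : (QuotientAddGroup.mk y : (ι → UnitAddCircle) ⧸ H) ≠ 0 := by
    rwa [Ne, QuotientAddGroup.eq_zero_iff]
  obtain ⟨ψ, hψ⟩ := exists_character_ne_zero_of_ne_zero hy'
  let s : ι → (UnitAddCircle →ₜ+ UnitAddCircle) := fun i =>
    ContinuousAddMonoidHom.mk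
      ((ψ.toAddMonoidHom.comp (QuotientAddGroup.mk' H)).comp
        (AddMonoidHom.single (fun _ : ι => UnitAddCircle) i)) (by
          exact ψ.continuous_toFun.comp (continuous_quotient_mk'.comp
            (continuous_single (A := fun _ : ι => UnitAddCircle) i)))
  choose m hm using fun i => exists_int_of_circle_character (s i)
  have key : ∀ z : ι → UnitAddCircle, ψ (QuotientAddGroup.mk z) = ∑ᶠ i, m i • z i := by
    intro z
    rw [finsum_eq_sum_of_fintype]
    simp_rw [← hm]
    conv_lhs => rw [← Finset.univ_sum_single z]
    change (ψ.toAddMonoidHom.comp (QuotientAddGroup.mk' H)) _ = _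
    rw [map_sum]
    rfl
  refine ⟨m, fun h hh => ?_, ?_⟩
  · rw [← key, (QuotientAddGroup.eq_zero_iff h).2 hh, map_zero]
  · rwa [← key]

variable {K : Type u} [AddCommGroup K] [TopologicalSpace K] [IsTopologicalAddGroup K]
  [CompactSpace K]

/-- Evaluation of characters at a point. -/
def evalHom (x : K) : (K →ₜ+ UnitAddCircle) →+ UnitAddCircle where
  toFun χ := χ x
  map_zero' := rfl
  map_add' _ _ := rfl

/-- Every homomorphism from the character group of `K` to the circle group is the evaluation at
a point of `K`. -/
theorem exists_eval_eq (v : (K →ₜ+ UnitAddCircle) →+ UnitAddCircle) : ∃ x, ∀ χ, χ x = v χ := by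
  let C : (K →ₜ+ UnitAddCircle) → Set K := fun χ => {x | χ x = v χ}
  have hC : ∀ χ, IsClosed (C χ) := fun χ =>
    isClosed_eq χ.continuous_toFun continuous_const
  have hne : (⋂ χ, C χ).Nonempty := by
    refine CompactSpace.iInter_nonempty hC fun F => ?_
    let q : K →+ (F → UnitAddCircle) := AddMonoidHom.mk' (fun x χ => χ.1 x) fun x y => by
      ext χ
      exact map_add _ _ _
    have hq : Continuous q := continuous_pi fun χ => χ.1.continuous_toFun
    have hcl : IsClosed (q.range : Set (F → UnitAddCircle)) := by
      rw [AddMonoidHom.coe_range]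
      exact (isCompact_range hq).isClosed
    by_cases hy : (fun χ : F => v χ.1) ∈ q.range
    · obtain ⟨x, hx⟩ := hy
      exact ⟨x, Set.mem_iInter₂.2 fun χ hχ => congrFun hx ⟨χ, hχ⟩⟩
    · obtain ⟨m, hm, hmy⟩ := exists_int_annihilator q.range hcl hy
      exfalso
      simp only [finsum_eq_sum_of_fintype] at hm hmy
      apply hmy
      -- An integral relation satisfied by the image of `K` is a relation between the characters
      -- themselves, which `v` must respect.
      have h0 : ∑ χ : F, m χ • χ.1 = 0 := by
        ext x
        change evalHom x _ = 0
        rw [map_sum]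
        simp_rw [map_zsmul]
        exact hm _ ⟨x, rfl⟩
      simp_rw [← map_zsmul, ← map_sum, h0, map_zero]
  obtain ⟨x, hx⟩ := hne
  exact ⟨x, fun χ => Set.mem_iInter.1 hx χ⟩

variable [T2Space K]

theorem eq_of_forall_character {x y : K} (h : ∀ χ : K →ₜ+ UnitAddCircle, χ x = χ y) : x = y := by
  by_contra hxy
  obtain ⟨χ, hχ⟩ := exists_character_ne_zero_of_ne_zero (sub_ne_zero.2 hxy)
  exact hχ (by rw [map_sub, h, sub_self])

/-- A compact abelian group carries the topology induced by its characters. -/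
theorem continuous_of_forall_character {X : Type*} [TopologicalSpace X] {f : X → K}
    (h : ∀ χ : K →ₜ+ UnitAddCircle, Continuous fun x => χ (f x)) : Continuous f := by
  let e : K → ((K →ₜ+ UnitAddCircle) → UnitAddCircle) := fun x χ => χ x
  have he : Continuous e := continuous_pi fun χ => χ.continuous_toFun
  have hi : Function.Injective e := fun x y hxy => eq_of_forall_character (congrFun hxy)
  exact (he.isClosedEmbedding hi).isInducing.continuous_iff.2 (continuous_pi h)

/-- Every neighbourhood of `0` contains the common kernel of finitely many characters. -/
theorem exists_finset_characters {V : Set K} (hV : V ∈ 𝓝 (0 : K)) :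
    ∃ F : Finset (K →ₜ+ UnitAddCircle), ∀ x, (∀ χ ∈ F, χ x = 0) → x ∈ V := by
  obtain ⟨U, hUV, hU, h0⟩ := mem_nhds_iff.1 hV
  let C : (K →ₜ+ UnitAddCircle) → Set K := fun χ => {x | χ x = 0}
  have hC : ∀ χ, IsClosed (C χ) := fun χ =>
    isClosed_eq χ.continuous_toFun continuous_const
  have hinter : Uᶜ ∩ ⋂ χ, C χ = ∅ := by
    refine Set.eq_empty_of_forall_notMem fun x hx => hx.1 ?_
    rwa [eq_of_forall_character (x := x) (y := 0) fun χ => by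
      rw [map_zero]; exact Set.mem_iInter.1 hx.2 χ]
  obtain ⟨F, hF⟩ := hU.isClosed_compl.isCompact.elim_finite_subfamily_closed C hC hinter
  refine ⟨F, fun x hx => hUV ?_⟩
  by_contra hxU
  exact (Set.eq_empty_iff_forall_notMem.1 hF x) ⟨hxU, Set.mem_iInter₂.2 hx⟩

end Duality

end CompactAbelian

namespace CompactAbelian

open MeasureTheory Filter Topology

/-! ### Extension of homomorphisms into divisible groups -/

section Divisible

variable {A D : Type*} [AddCommGroup A] [AddCommGroup D] [DivisibleBy D ℤ]

/-- A homomorphism into a divisible group may be prescribed on a linearly independent family. -/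
theorem exists_hom_of_linearIndependent {ι : Type*} {v : ι → A} (hv : LinearIndependent ℤ v)
    (g : ι → D) : ∃ h : A →+ D, ∀ i, h (v i) = g i := by
  obtain ⟨h, hh⟩ := (Module.Baer.of_divisible D).extension_property
    (Finsupp.linearCombination ℤ v) hv (Finsupp.linearCombination ℤ g)
  refine ⟨h.toAddMonoidHom, fun i => ?_⟩
  have := LinearMap.congr_fun hh (Finsupp.single i 1)
  simpa using this

/-- A homomorphism into a divisible group may be prescribed on a single element. -/
theorem exists_hom_apply_eq (a : A) (d : D) (had : ∀ n : ℤ, n • a = 0 → n • d = 0) :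
    ∃ h : A →+ D, h a = d := by
  let fa := LinearMap.toSpanSingleton ℤ A a
  let fd := LinearMap.toSpanSingleton ℤ D d
  have hker : LinearMap.ker fa ≤ LinearMap.ker fd := fun n hn => by
    simp only [fa, fd, LinearMap.mem_ker, LinearMap.toSpanSingleton_apply] at hn ⊢
    exact had n hn
  obtain ⟨h, hh⟩ := (Module.Baer.of_divisible D).extension_property
    ((LinearMap.ker fa).liftQ fa le_rfl)
    (LinearMap.ker_eq_bot.1 (Submodule.ker_liftQ_eq_bot _ _ _ le_rfl))
    ((LinearMap.ker fa).liftQ fd hker)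
  refine ⟨h.toAddMonoidHom, ?_⟩
  have := LinearMap.congr_fun hh (Submodule.Quotient.mk 1)
  rw [LinearMap.comp_apply, Submodule.liftQ_apply, Submodule.liftQ_apply] at this
  simpa [fa, fd] using this

end Divisible

/-! ### Prüfer groups and homomorphisms from the `p`-adic integers -/

section Prufer

/-- The subgroup of elements of `p`-power order of the circle group. -/
def prufer (p : ℕ) : AddSubgroup UnitAddCircle where
  carrier := {t | ∃ n : ℕ, p ^ n • t = 0}
  zero_mem' := ⟨0, smul_zero _⟩
  add_mem' := by
    rintro s t ⟨m, hm⟩ ⟨n, hn⟩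
    refine ⟨m + n, ?_⟩
    rw [smul_add, pow_add, mul_comm, mul_smul, hm, mul_comm, mul_smul, hn]
    simp
  neg_mem' := by
    rintro t ⟨n, hn⟩
    exact ⟨n, by rw [smul_neg, hn, neg_zero]⟩

/-- Write `m = p ^ k * m'` with `m'` prime to `p`: divide by `p ^ k` in the circle, then invert `m'`
on `p ^ (k + n)`-torsion by Bézout. -/
theorem prufer_zsmul_surjective (p : ℕ) [hp : Fact p.Prime] {m : ℤ} (hm : m ≠ 0) :
    Function.Surjective fun t : prufer p => m • t := by
  rintro ⟨t, n, hn⟩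
  let k := padicValInt p m
  obtain ⟨m', hm'⟩ : (p : ℤ) ^ k ∣ m := padicValInt_dvd m
  have hcop : IsCoprime ((p : ℤ) ^ (k + n)) m' := by
    refine IsCoprime.pow_left ?_
    rw [(Nat.prime_iff_prime_int.1 hp.out).coprime_iff_not_dvd]
    rintro ⟨c, rfl⟩
    have h : (p : ℤ) ^ (k + 1) ∣ m := ⟨c, by rw [hm']; ring⟩
    rw [padicValInt_dvd_iff] at h
    omega
  obtain ⟨a, b, hab⟩ := hcop
  let s : UnitAddCircle := DivisibleBy.div t ((p : ℤ) ^ k)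
  have hs : (p : ℤ) ^ k • s = t := DivisibleBy.div_cancel t (pow_ne_zero _ (by
    exact_mod_cast hp.out.ne_zero))
  have hs' : (p : ℤ) ^ (k + n) • s = 0 := by
    rw [pow_add, mul_comm, mul_smul, hs]
    exact_mod_cast hn
  have hsz : p ^ (k + n) • s = 0 := by exact_mod_cast hs'
  refine ⟨⟨b • s, k + n, ?_⟩, Subtype.ext ?_⟩
  · rw [smul_comm, hsz, smul_zero]
  · change m • b • s = t
    have h1 : m' • b • s = s := by
      rw [← mul_smul]
      have : m' * b = 1 - a * (p : ℤ) ^ (k + n) := by linear_combination hab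
      rw [this, sub_smul, one_smul, mul_smul, hs', smul_zero, sub_zero]
    rw [hm', mul_smul, h1, hs]

noncomputable instance (p : ℕ) [Fact p.Prime] : DivisibleBy (prufer p) ℤ :=
  divisibleByOfSMulRightSurj _ _ fun hm => prufer_zsmul_surjective p hm

variable {K : Type u} [AddCommGroup K] [TopologicalSpace K] [IsTopologicalAddGroup K]
  [CompactSpace K] [T2Space K]

/-- A non-trivial compact abelian group contains a non-trivial element whose multiples by powers
of some prime `p` converge to `0`. -/
theorem exists_topologically_pTorsion [Nontrivial K] :
    ∃ p : ℕ, p.Prime ∧ ∃ x : K, x ≠ 0 ∧ ∀ χ : K →ₜ+ UnitAddCircle, ∃ n : ℕ, p ^ n • χ x = 0 := by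
  obtain ⟨y, hy⟩ := exists_ne (0 : K)
  obtain ⟨a, ha⟩ := exists_character_ne_zero_of_ne_zero hy
  have ha0 : a ≠ 0 := fun h => ha (by rw [h]; rfl)
  -- If `a` has infinite order, `addOrderOf a = 0` and any prime will do.
  obtain ⟨p, hp, hpa⟩ : ∃ p : ℕ, p.Prime ∧ p ∣ addOrderOf a :=
    Nat.exists_prime_and_dvd fun h => ha0 (AddMonoid.addOrderOf_eq_one_iff.1 h)
  have := Fact.mk hp
  have hp0 : (p : ℝ) ≠ 0 := by exact_mod_cast hp.ne_zero
  let d₀ : UnitAddCircle := ((1 / p : ℝ) : UnitAddCircle)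
  have hd₀ : addOrderOf d₀ = p := AddCircle.addOrderOf_period_div hp.pos
  have hpd : p • d₀ = 0 := by
    conv_lhs => rw [← hd₀]
    exact addOrderOf_nsmul_eq_zero d₀
  let d : prufer p := ⟨d₀, 1, by rwa [pow_one]⟩
  obtain ⟨h, hh⟩ := exists_hom_apply_eq a d fun n hn => Subtype.ext (by
    have h1 : (p : ℤ) ∣ n :=
      (Int.natCast_dvd_natCast.2 hpa).trans (addOrderOf_dvd_iff_zsmul_eq_zero.2 hn)
    change n • d₀ = 0
    rwa [← addOrderOf_dvd_iff_zsmul_eq_zero, hd₀])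
  obtain ⟨x, hx⟩ := exists_eval_eq ((prufer p).subtype.comp h)
  refine ⟨p, hp, x, ?_, fun χ => ?_⟩
  · rintro rfl
    have h1 := hx a
    rw [map_zero, AddMonoidHom.comp_apply, hh] at h1
    have h2 : addOrderOf d₀ = 1 := AddMonoid.addOrderOf_eq_one_iff.2 h1.symm
    exact hp.one_lt.ne (h2.symm.trans hd₀)
  · rw [hx]
    exact (h χ).2

/-- An element whose multiples by powers of `p` converge to `0` is the image of `1` under a
continuous homomorphism from the `p`-adic integers. -/
theorem exists_padicInt_hom (p : ℕ) [hp : Fact p.Prime] (x : K)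
    (hx : ∀ χ : K →ₜ+ UnitAddCircle, ∃ n : ℕ, p ^ n • χ x = 0) :
    ∃ Φ : ℤ_[p] →ₜ+ K, Φ 1 = x := by
  -- On `p ^ N`-torsion an integer acts through its residue modulo `p ^ N`, so a `p`-adic integer
  -- acts through any sufficiently close integer.
  have hwd : ∀ (t : UnitAddCircle) (N M : ℕ) (k l : ℤ) (z : ℤ_[p]), p ^ N • t = 0 →
      p ^ M • t = 0 → (p : ℤ_[p]) ^ N ∣ z - k → (p : ℤ_[p]) ^ M ∣ z - l → k • t = l • t := by
    intro t N M k l z hN hM hk hl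
    wlog hNM : N ≤ M generalizing N M k l
    · exact (this M N l k hM hN hl hk (le_of_not_ge hNM)).symm
    have h : (p : ℤ_[p]) ^ N ∣ ((k - l : ℤ) : ℤ_[p]) := by
      have := dvd_sub ((pow_dvd_pow _ hNM).trans hl) hk
      push_cast
      convert this using 1
      ring
    rw [← Ideal.mem_span_singleton, ← PadicInt.norm_le_pow_iff_mem_span_pow,
      PadicInt.norm_int_le_pow_iff_dvd] at h
    obtain ⟨c, hc⟩ := h
    have hN' : (p : ℤ) ^ N • t = 0 := by exact_mod_cast hN
    rw [← sub_eq_zero, ← sub_smul, hc, mul_comm, mul_smul, hN', smul_zero]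
  have happr : ∀ (z : ℤ_[p]) (N : ℕ), (p : ℤ_[p]) ^ N ∣ z - ((z.appr N : ℤ) : ℤ_[p]) := by
    intro z N
    have := PadicInt.appr_spec N z
    rw [Ideal.mem_span_singleton] at this
    exact_mod_cast this
  have hmono : ∀ (t : UnitAddCircle) (N M : ℕ), N ≤ M → p ^ N • t = 0 → p ^ M • t = 0 := by
    intro t N M hNM h
    obtain ⟨c, hc⟩ := pow_dvd_pow p hNM
    rw [hc, mul_comm, mul_smul, h, smul_zero]
  choose N hN using hx
  have hex : ∀ z : ℤ_[p], ∃ y : K, ∀ (χ : K →ₜ+ UnitAddCircle) (M : ℕ) (k : ℤ), p ^ M • χ x = 0 →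
      (p : ℤ_[p]) ^ M ∣ z - k → χ y = k • χ x := by
    intro z
    obtain ⟨y, hy⟩ := exists_eval_eq (AddMonoidHom.mk'
      (fun χ : K →ₜ+ UnitAddCircle => (z.appr (N χ) : ℤ) • χ x) fun χ ψ => by
        let M := max (max (N χ) (N ψ)) (N (χ + ψ))
        have h : ∀ ρ : K →ₜ+ UnitAddCircle, N ρ ≤ M →
            (z.appr (N ρ) : ℤ) • ρ x = (z.appr M : ℤ) • ρ x := fun ρ hρ =>
          hwd _ _ _ _ _ z (hN ρ) (hmono _ _ _ hρ (hN ρ)) (happr _ _) (happr _ _)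
        rw [h _ (le_max_right _ _), h χ ((le_max_left _ _).trans (le_max_left _ _)),
          h ψ ((le_max_right _ _).trans (le_max_left _ _)), ← smul_add]
        rfl)
    refine ⟨y, fun χ M k hM hk => ?_⟩
    rw [hy]
    exact hwd _ _ _ _ _ z (hN χ) hM (happr _ _) hk
  choose Φ hΦ using hex
  have hadd : ∀ z w, Φ (z + w) = Φ z + Φ w := by
    refine fun z w => eq_of_forall_character fun χ => ?_
    rw [map_add, hΦ z χ _ _ (hN χ) (happr _ _), hΦ w χ _ _ (hN χ) (happr _ _), ← add_smul]
    refine hΦ _ χ _ _ (hN χ) ?_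
    convert dvd_add (happr z (N χ)) (happr w (N χ)) using 1
    push_cast
    ring
  have hcont : Continuous Φ := by
    refine continuous_of_forall_character fun χ => ?_
    let f : ℤ_[p] →+ UnitAddCircle := AddMonoidHom.mk' (fun z => χ (Φ z)) fun z w => by
      rw [hadd, map_add]
    refine continuous_of_continuousAt_zero f ?_
    refine ContinuousAt.congr (f := fun _ => (0 : UnitAddCircle)) continuousAt_const ?_
    have hp1 : (0 : ℝ) < (p : ℝ) ^ (-(N χ) : ℤ) := by
      have := hp.out.pos
      positivity
    filter_upwards [Metric.closedBall_mem_nhds (0 : ℤ_[p]) hp1] with z hz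
    rw [mem_closedBall_zero_iff, PadicInt.norm_le_pow_iff_mem_span_pow,
      Ideal.mem_span_singleton] at hz
    have := hΦ z χ (N χ) 0 (hN χ) (by simpa using hz)
    rw [zero_smul] at this
    exact this.symm
  refine ⟨ContinuousAddMonoidHom.mk (AddMonoidHom.mk' Φ hadd) hcont,
    eq_of_forall_character fun χ => ?_⟩
  change χ (Φ 1) = χ x
  rw [hΦ 1 χ (N χ) 1 (hN χ) (by simp), one_smul]

end Prufer

/-! ### Prime-order elements or copies of the `p`-adic integers -/

section Monothetic

theorem IsPMonothetic.of_equiv (p : ℕ) [Fact p.Prime] {A B : Type*} [AddCommGroup A]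
    [TopologicalSpace A] [AddCommGroup B] [TopologicalSpace B] (e : A ≃ₜ+ B)
    (h : IsPMonothetic p A) : IsPMonothetic p B := by
  obtain ⟨⟨a, ha⟩, h⟩ := h
  refine ⟨⟨e a, ?_⟩, ?_⟩
  · refine (e.surjective.denseRange.dense_image e.continuous ha).mono ?_
    rintro _ ⟨_, ⟨n, rfl⟩, rfl⟩
    exact ⟨n, (map_zsmul e n a).symm⟩
  · rcases h with ⟨hc, k, hk⟩ | ⟨H, ⟨f⟩⟩
    · refine Or.inl ⟨isAddCyclic_of_surjective e.toAddEquiv e.toAddEquiv.surjective, k, ?_⟩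
      rw [← hk]
      exact (Nat.card_congr e.toEquiv).symm
    · exact Or.inr ⟨H, ⟨e.symm.trans f⟩⟩

/-- A continuous injective homomorphism from a compact group to a Hausdorff group restricts to an
isomorphism onto the image of any closed subgroup. -/
noncomputable def equivMapOfInjective {L K : Type*} [AddCommGroup L] [TopologicalSpace L]
    [CompactSpace L] [AddCommGroup K] [TopologicalSpace K] [T2Space K] (f : L →+ K)
    (hf : Continuous f) (hi : Function.Injective f) (C : AddSubgroup L)
    (hC : IsClosed (C : Set L)) : C ≃ₜ+ C.map f :=
  have : CompactSpace C := isCompact_iff_compactSpace.1 hC.isCompact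
  have hc : Continuous (C.equivMapOfInjective f hi) :=
    Continuous.subtype_mk (hf.comp continuous_subtype_val) _
  { C.equivMapOfInjective f hi with
    continuous_toFun := hc
    continuous_invFun := hc.continuous_symm_of_equiv_compact_to_t2 }

/-- The `p`-adic integers as a subgroup of themselves. -/
noncomputable def padicIntEquivTop (p : ℕ) [Fact p.Prime] : ℤ_[p] ≃ₜ+ (⊤ : AddSubgroup ℤ_[p]) :=
  { (AddSubgroup.topEquiv (G := ℤ_[p])).symm with
    continuous_toFun := Continuous.subtype_mk continuous_id _
    continuous_invFun := continuous_subtype_val }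

theorem isPMonothetic_padicInt (p : ℕ) [Fact p.Prime] : IsPMonothetic p ℤ_[p] := by
  refine ⟨⟨1, ?_⟩, Or.inr ⟨⊤, ⟨padicIntEquivTop p⟩⟩⟩
  have h : (AddSubgroup.zmultiples (1 : ℤ_[p]) : Set ℤ_[p]) = Set.range (Int.cast : ℤ → ℤ_[p]) := by
    ext z
    simp [AddSubgroup.mem_zmultiples_iff]
  rw [h]
  exact PadicInt.denseRange_intCast

variable {K : Type u} [AddCommGroup K] [TopologicalSpace K]

/-- Weak essentiality passes to compact subgroups. -/
theorem isWeaklyEssential_comap [T2Space K] {L : Type*} [AddCommGroup L] [TopologicalSpace L]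
    [CompactSpace L] (f : L →+ K) (hf : Continuous f) (hi : Function.Injective f)
    {G : AddSubgroup K} (hG : G.IsWeaklyEssential) : (G.comap f).IsWeaklyEssential := by
  intro p _ C hC hinf hmon hbot
  refine hG p (C.map f) ?_ ?_ (IsPMonothetic.of_equiv p (equivMapOfInjective f hf hi C hC) hmon) ?_
  · rw [AddSubgroup.coe_map]
    exact (hC.isCompact.image hf).isClosed
  · rw [AddSubgroup.coe_map]
    exact hinf.image hi.injOn
  · rw [AddSubgroup.eq_bot_iff_forall] at hbot ⊢
    rintro _ ⟨hxG, x, hx, rfl⟩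
    rw [hbot x ⟨hxG, hx⟩, map_zero]

variable [IsTopologicalAddGroup K] [CompactSpace K] [T2Space K]

/-- A non-trivial compact abelian group has an element of prime order or contains a copy of the
`p`-adic integers for some prime `p`. -/
theorem exists_prime_order_or_padicInt [Nontrivial K] :
    (∃ p : ℕ, p.Prime ∧ ∃ y : K, y ≠ 0 ∧ p • y = 0) ∨
      ∃ (p : ℕ) (_ : Fact p.Prime) (C : AddSubgroup K), IsClosed (C : Set K) ∧
        (C : Set K).Infinite ∧ IsPMonothetic p C := by
  obtain ⟨p, hp, x, hx0, hx⟩ := exists_topologically_pTorsion (K := K)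
  have := Fact.mk hp
  obtain ⟨Φ, hΦ⟩ := exists_padicInt_hom p x hx
  by_cases hi : Function.Injective Φ
  · right
    let f : ℤ_[p] →+ K := Φ.toAddMonoidHom
    have hf : Continuous f := Φ.continuous_toFun
    refine ⟨p, this, (⊤ : AddSubgroup ℤ_[p]).map f, ?_, ?_, ?_⟩
    · rw [AddSubgroup.coe_map]
      exact (isClosed_univ.isCompact.image hf).isClosed
    · rw [AddSubgroup.coe_map, AddSubgroup.coe_top]
      exact Set.infinite_univ.image hi.injOn
    · exact IsPMonothetic.of_equiv p ((padicIntEquivTop p).trans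
        (equivMapOfInjective f hf hi ⊤ isClosed_univ)) (isPMonothetic_padicInt p)
  · left
    obtain ⟨z, hz0, hz⟩ : ∃ z, z ≠ 0 ∧ Φ z = 0 := by
      rw [injective_iff_map_eq_zero] at hi
      push Not at hi
      obtain ⟨z, h1, h2⟩ := hi
      exact ⟨z, h2, h1⟩
    -- By density of the integers the closed kernel absorbs multiplication, so it contains a power
    -- of `p`.
    have hmul : ∀ w, Φ (w * z) = 0 := by
      intro w
      refine DenseRange.induction_on (p := fun w => Φ (w * z) = 0) PadicInt.denseRange_intCast w
        ?_ fun n => ?_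
      · exact isClosed_eq (Φ.continuous_toFun.comp (continuous_mul_const z)) continuous_const
      · rw [← zsmul_eq_mul, map_zsmul, hz, smul_zero]
    have hpk : ∃ k : ℕ, p ^ k • x = 0 := by
      refine ⟨z.valuation, ?_⟩
      have h1 := hmul ((PadicInt.unitCoeff hz0)⁻¹ : ℤ_[p]ˣ)
      have h2 : ((PadicInt.unitCoeff hz0)⁻¹ : ℤ_[p]ˣ) * z = ((p ^ z.valuation : ℕ) : ℤ_[p]) := by
        rw [Units.inv_mul_eq_iff_eq_mul]
        push_cast
        exact PadicInt.unitCoeff_spec hz0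
      rw [h2, ← nsmul_one, map_nsmul, hΦ] at h1
      exact h1
    classical
    have hk := Nat.find_spec hpk
    have hk0 : Nat.find hpk ≠ 0 := fun h => hx0 (by rw [h, pow_zero, one_smul] at hk; exact hk)
    obtain ⟨j, hj⟩ := Nat.exists_eq_succ_of_ne_zero hk0
    refine ⟨p, hp, p ^ j • x, Nat.find_min hpk (by omega), ?_⟩
    rw [← mul_smul, ← pow_succ', ← Nat.succ_eq_add_one, ← hj]
    exact hk

end Monothetic

end CompactAbelian

namespace CompactAbelian

open Filter Topology

theorem mem_torsionBy_iff {K : Type*} [AddCommGroup K] {p : ℕ} {x : K} :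
    x ∈ AddSubgroup.torsionBy K (p : ℤ) ↔ p • x = 0 := by
  rw [← natCast_zsmul]
  exact Submodule.mem_torsionBy_iff _ _

/-! ### Small subgroups -/

section SmallSubgroups

/-- The circle group has no small subgroups. -/
theorem circle_eq_zero_of_multiples_small {t : UnitAddCircle} (h : ∀ n : ℕ, ‖n • t‖ < 1 / 4) :
    t = 0 := by
  obtain ⟨x, rfl, hx⟩ : ∃ x : ℝ, (x : UnitAddCircle) = t ∧ |x| ≤ 1 / 2 := by
    obtain ⟨y, rfl⟩ := QuotientAddGroup.mk_surjective t
    refine ⟨y - round y, ?_, abs_sub_round y⟩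
    rw [AddCircle.coe_sub]
    have : ((round y : ℝ) : UnitAddCircle) = 0 := by
      have := AddCircle.coe_period (1 : ℝ)
      rw [← mul_one (round y : ℝ), ← zsmul_eq_mul, AddCircle.coe_zsmul, this, smul_zero]
    rw [this, sub_zero]
  have hnorm : ∀ y : ℝ, |y| ≤ 1 / 2 → ‖(y : UnitAddCircle)‖ = |y| := fun y hy =>
    (AddCircle.norm_coe_eq_abs_iff (1 : ℝ) one_ne_zero).2 (by simpa using hy)
  by_contra hx0
  have hxpos : 0 < |x| := abs_pos.2 fun h0 => hx0 (by rw [h0]; rfl)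
  have h1 := h 1
  rw [one_smul, hnorm x hx] at h1
  -- This `n` puts `n * |x|` in `[1/4, 1/2]`, where the circle norm is still the absolute value.
  let n := ⌈1 / (4 * |x|)⌉₊
  have hn1 : 1 / (4 * |x|) ≤ n := Nat.le_ceil _
  have hn2 : (n : ℝ) < 1 / (4 * |x|) + 1 := Nat.ceil_lt_add_one (by positivity)
  have e : 1 / (4 * |x|) * |x| = 1 / 4 := by field_simp
  have hn1' : 1 / 4 ≤ n * |x| := by
    rw [← e]; exact mul_le_mul_of_nonneg_right hn1 hxpos.le
  have hn2' : n * |x| ≤ 1 / 2 := by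
    have := mul_le_mul_of_nonneg_right hn2.le hxpos.le
    rw [add_mul, e] at this
    linarith
  have := h n
  rw [← AddCircle.coe_nsmul, nsmul_eq_mul, hnorm _ (by rwa [abs_mul, Nat.abs_cast]), abs_mul,
    Nat.abs_cast] at this
  linarith

/-- In a compact totally disconnected group, some non-zero integer multiplies the whole group into
a given neighbourhood of `0`, along with all multiples. -/
theorem exists_nsmul_mem_of_totallyDisconnected {L : Type*} [AddCommGroup L] [TopologicalSpace L]
    [IsTopologicalAddGroup L] [CompactSpace L] [TotallyDisconnectedSpace L] {U : Set L}
    (hU : U ∈ 𝓝 (0 : L)) :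
    ∃ (H : AddSubgroup L) (d : ℕ), d ≠ 0 ∧ (H : Set L) ⊆ U ∧ ∀ x, d • x ∈ H := by
  obtain ⟨W, hWU, hW, h0⟩ := mem_nhds_iff.1 hU
  obtain ⟨H, hH⟩ := ProfiniteGrp.exist_openNormalAddSubgroup_sub_open_nhds_of_zero hW h0
  have : H.toAddSubgroup.FiniteIndex :=
    AddSubgroup.finiteIndex_of_finite_quotient (H := H.toAddSubgroup)
  exact ⟨H.toAddSubgroup, H.toAddSubgroup.index, AddSubgroup.FiniteIndex.index_ne_zero,
    hH.trans hWU, fun x => AddSubgroup.nsmul_index_mem _ x⟩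

/-- A character takes finitely many values on a closed totally disconnected subgroup. -/
theorem exists_nsmul_character_eq_zero {K : Type*} [AddCommGroup K] [TopologicalSpace K]
    [IsTopologicalAddGroup K] [CompactSpace K] (χ : K →ₜ+ UnitAddCircle) (N : AddSubgroup K)
    (hN : IsClosed (N : Set K)) (hd : IsTotallyDisconnected (N : Set K)) :
    ∃ d : ℕ, d ≠ 0 ∧ ∀ x ∈ N, d • χ x = 0 := by
  have : CompactSpace N := isCompact_iff_compactSpace.1 hN.isCompact
  have : TotallyDisconnectedSpace N := totallyDisconnectedSpace_subtype_iff.2 hd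
  have hc : Continuous fun x : N => χ x := χ.continuous_toFun.comp continuous_subtype_val
  obtain ⟨H, d, hd0, hHU, hHd⟩ := exists_nsmul_mem_of_totallyDisconnected (L := N)
    (hc.continuousAt.preimage_mem_nhds (t := Metric.ball 0 (1 / 4)) (by
      rw [ZeroMemClass.coe_zero, map_zero]
      exact Metric.ball_mem_nhds _ (by norm_num)))
  refine ⟨d, hd0, fun x hx => circle_eq_zero_of_multiples_small fun n => ?_⟩
  have := hHU (H.nsmul_mem (hHd ⟨x, hx⟩) n)
  rw [Set.mem_preimage, mem_ball_zero_iff] at this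
  rw [← map_nsmul, ← map_nsmul]
  exact this

end SmallSubgroups

/-! ### Local essentiality through elements of prime order -/

section LocalEssentiality

variable {K : Type u} [AddCommGroup K] [TopologicalSpace K]

/-- A subgroup meeting a subgroup of prime order non-trivially contains it. -/
theorem mem_of_inf_zmultiples_ne_bot {G : AddSubgroup K} {p : ℕ} (hp : p.Prime) {x : K}
    (hx : p • x = 0) (h : G ⊓ AddSubgroup.zmultiples x ≠ ⊥) : x ∈ G := by
  obtain ⟨⟨y, hyG, k, hk⟩, hy⟩ := AddSubgroup.ne_bot_iff_exists_ne_zero.1 h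
  have hy0 : k • x ≠ 0 := fun h0 => hy (Subtype.ext (hk.symm.trans h0))
  have hx' : (p : ℤ) • x = 0 := by rwa [natCast_zsmul]
  have hcop : IsCoprime (p : ℤ) k := by
    rw [(Nat.prime_iff_prime_int.1 hp).coprime_iff_not_dvd]
    rintro ⟨c, rfl⟩
    exact hy0 (by rw [mul_comm, mul_smul, hx', smul_zero])
  obtain ⟨a, b, hab⟩ := hcop
  have : x = b • (k • x) := by
    rw [← mul_smul, ← sub_eq_of_eq_add' hab.symm, sub_smul, one_smul, mul_smul, hx', smul_zero,
      sub_zero]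
  rw [this]
  refine G.zsmul_mem ?_ b
  change k • x = y at hk
  rwa [hk]

/-- A cyclic subgroup of prime order is finite, hence closed, and `G` contains it as soon as it
meets it non-trivially. -/
theorem IsLocallyEssential.exists_nhds [T1Space K] {G : AddSubgroup K}
    (hG : G.IsLocallyEssential) :
    ∃ V ∈ 𝓝 (0 : K), ∀ p : ℕ, p.Prime → ∀ x : K, p • x = 0 →
      (AddSubgroup.zmultiples x : Set K) ⊆ V → x ∈ G := by
  obtain ⟨V, hV, h⟩ := hG
  refine ⟨V, hV, fun p hp x hx hxV => ?_⟩
  by_cases hx0 : x = 0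
  · rw [hx0]
    exact G.zero_mem
  refine mem_of_inf_zmultiples_ne_bot hp hx (h _ ?_ (by simpa using hx0) hxV)
  have hfin : IsOfFinAddOrder x := isOfFinAddOrder_iff_nsmul_eq_zero.2 ⟨p, hp.pos, hx⟩
  have : (AddSubgroup.zmultiples x : Set K).Finite := by
    rw [← finite_zmultiples] at hfin
    exact hfin
  exact this.isClosed

variable [IsTopologicalAddGroup K] [CompactSpace K] [T2Space K]

/-- A non-trivial closed `S` inside `V` contains an element of prime order, which lies in `G` by the
choice of `V`, or an infinite closed `p`-monothetic subgroup, which weak essentiality handles. -/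
theorem isLocallyEssential_of_exists_nhds {G : AddSubgroup K} (hG : G.IsWeaklyEssential)
    (h : ∃ V ∈ 𝓝 (0 : K), ∀ p : ℕ, p.Prime → ∀ x : K, p • x = 0 →
      (AddSubgroup.zmultiples x : Set K) ⊆ V → x ∈ G) : G.IsLocallyEssential := by
  obtain ⟨V, hV, h⟩ := h
  refine ⟨V, hV, fun S hS hS0 hSV hbot => ?_⟩
  have : CompactSpace S := isCompact_iff_compactSpace.1 hS.isCompact
  have : Nontrivial S := (AddSubgroup.nontrivial_iff_ne_bot S).2 hS0
  rw [AddSubgroup.eq_bot_iff_forall] at hbot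
  rcases exists_prime_order_or_padicInt (K := S) with ⟨p, hp, y, hy0, hy⟩ | ⟨p, _, C, hC, hi, hm⟩
  · refine hy0 (Subtype.ext (hbot y ⟨h p hp y ?_ ?_, y.2⟩))
    · exact_mod_cast congrArg Subtype.val hy
    · refine Set.Subset.trans ?_ hSV
      exact AddSubgroup.zmultiples_le.2 y.2
  · refine isWeaklyEssential_comap S.subtype continuous_subtype_val Subtype.val_injective hG p C
      hC hi hm ?_
    rw [AddSubgroup.eq_bot_iff_forall]
    rintro x ⟨hxG, -⟩
    exact Subtype.ext (hbot x ⟨hxG, x.2⟩)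

/-- Openness of the `p`-torsion and finiteness of the set of exceptional primes imply local
essentiality. -/
theorem isLocallyEssential_of_pTorsionOpen {G : AddSubgroup K} (hG : G.IsWeaklyEssential)
    (ho : G.PTorsionOpen) (hf : ((⊤ : AddSubgroup K).torsionPrimes G).Finite) :
    G.IsLocallyEssential := by
  have hV : ∀ p : ℕ, ∃ V ∈ 𝓝 (0 : K), p.Prime → ∀ x ∈ V, p • x = 0 → x ∈ G := by
    intro p
    by_cases hp : p.Prime
    · have h1 : (G.pTorsionIn p : Set (AddSubgroup.torsionBy K (p : ℤ))) ∈ 𝓝 0 :=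
        (ho p hp).mem_nhds (G.pTorsionIn p).zero_mem
      rw [nhds_subtype_eq_comap] at h1
      obtain ⟨V, hV, hVG⟩ := h1
      refine ⟨V, hV, fun _ x hxV hx => ?_⟩
      have := hVG (a := ⟨x, mem_torsionBy_iff.2 hx⟩) hxV
      exact this.1
    · exact ⟨Set.univ, univ_mem, fun h => absurd h hp⟩
  choose V hV hVG using hV
  refine isLocallyEssential_of_exists_nhds hG ⟨⋂ p ∈ (⊤ : AddSubgroup K).torsionPrimes G, V p,
    (biInter_mem hf).2 fun p _ => hV p, fun p hp x hx hxV => ?_⟩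
  by_cases hpG : p ∈ (⊤ : AddSubgroup K).torsionPrimes G
  · exact hVG p hp x (Set.mem_iInter₂.1 (hxV (AddSubgroup.mem_zmultiples x)) p hpG) hx
  · by_contra hxG
    exact hpG ⟨hp, fun hle => hxG (hle ⟨trivial, mem_torsionBy_iff.2 hx⟩)⟩

/-- For a locally essential subgroup the exceptional primes of a closed totally disconnected
subgroup are finite in number. -/
theorem IsLocallyEssential.finite_torsionPrimes {G : AddSubgroup K} (hG : G.IsLocallyEssential)
    (M : AddSubgroup K) (hM : IsClosed (M : Set K)) (hd : IsTotallyDisconnected (M : Set K)) :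
    (M.torsionPrimes G).Finite := by
  obtain ⟨V, hV, h⟩ := IsLocallyEssential.exists_nhds hG
  have : CompactSpace M := isCompact_iff_compactSpace.1 hM.isCompact
  have : TotallyDisconnectedSpace M := totallyDisconnectedSpace_subtype_iff.2 hd
  obtain ⟨H, d, hd0, hHV, hHd⟩ := exists_nsmul_mem_of_totallyDisconnected (L := M)
    (U := Subtype.val ⁻¹' V) (continuous_subtype_val.continuousAt.preimage_mem_nhds hV)
  refine (Set.finite_Iic d).subset fun p hp => ?_
  by_contra hpd
  rw [Set.mem_Iic, not_le] at hpd
  refine hp.2 fun x hx => ?_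
  have hxp : p • x = 0 := mem_torsionBy_iff.1 hx.2
  have hcop : IsCoprime (p : ℤ) d := by
    rw [Nat.isCoprime_iff_coprime, hp.1.coprime_iff_not_dvd]
    exact Nat.not_dvd_of_pos_of_lt (Nat.pos_of_ne_zero hd0) hpd
  obtain ⟨a, b, hab⟩ := hcop
  let y : M := ⟨x, hx.1⟩
  have hy : (p : ℤ) • y = 0 := Subtype.ext (by
    rw [natCast_zsmul]
    exact hxp)
  -- `p` is coprime to `d`, so `y` is a multiple of `d • y`.
  have hyH : y ∈ H := by
    have : y = b • (d • y) := by
      rw [← natCast_zsmul, ← mul_smul, ← sub_eq_of_eq_add' hab.symm, sub_smul, one_smul, mul_smul,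
        hy, smul_zero, sub_zero]
    rw [this]
    exact H.zsmul_mem (hHd y) b
  refine h p hp.1 x hxp ?_
  rintro _ ⟨k, rfl⟩
  exact hHV (H.zsmul_mem hyH k)

theorem finite_circle_torsion {p : ℕ} (hp : p ≠ 0) : {t : UnitAddCircle | p • t = 0}.Finite :=
  AddCircle.finite_torsion 1 (Nat.pos_of_ne_zero hp)

/-- `G[p]` contains the kernel of a continuous map from `K[p]` to a finite power of the circle's
`p`-torsion. The number of characters needed does not depend on `p`. -/
theorem IsLocallyEssential.pTorsionOpen_and_bounded {G : AddSubgroup K}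
    (hG : G.IsLocallyEssential) :
    G.PTorsionOpen ∧ ∃ n : ℕ, ∀ p : ℕ, p.Prime →
      pRank p (AddSubgroup.torsionBy K (p : ℤ) ⧸ G.pTorsionIn p) ≤ (n : Cardinal.{u}) := by
  obtain ⟨V, hV, h⟩ := IsLocallyEssential.exists_nhds hG
  obtain ⟨F, hF⟩ := exists_finset_characters hV
  have hFG : ∀ p : ℕ, p.Prime → ∀ x : K, p • x = 0 → (∀ χ ∈ F, χ x = 0) → x ∈ G := by
    refine fun p hp x hx hχ => h p hp x hx ?_
    rintro _ ⟨k, rfl⟩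
    refine hF _ fun χ hχF => ?_
    simp [hχ χ hχF]
  constructor
  · intro p hp
    -- Zero is isolated in the finite `p`-torsion of the circle, so for a `p`-torsion point a small
    -- character value is zero.
    have hW : {t : UnitAddCircle | p • t = 0 → t = 0} ∈ 𝓝 0 := by
      have : IsOpen ({t : UnitAddCircle | p • t = 0} \ {0})ᶜ :=
        ((finite_circle_torsion hp.ne_zero).subset Set.sdiff_subset).isClosed.isOpen_compl
      refine mem_of_superset (this.mem_nhds (by simp)) fun t ht hpt => ?_
      by_contra ht0
      exact ht ⟨hpt, ht0⟩
    refine AddSubgroup.isOpen_of_mem_nhds _ (g := 0) ?_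
    have hmem : (⋂ χ ∈ F, {x : AddSubgroup.torsionBy K (p : ℤ) |
        p • χ (x : K) = 0 → χ (x : K) = 0}) ∈ 𝓝 0 := by
      refine (biInter_finset_mem F).2 fun χ _ => ?_
      have hc : Continuous fun x : AddSubgroup.torsionBy K (p : ℤ) => χ (x : K) :=
        χ.continuous_toFun.comp continuous_subtype_val
      refine hc.continuousAt.preimage_mem_nhds (t := {t | p • t = 0 → t = 0}) ?_
      simpa using hW
    refine mem_of_superset hmem fun x hx => ?_
    have hxp : p • (x : K) = 0 := mem_torsionBy_iff.1 x.2
    refine ⟨hFG p hp x hxp fun χ hχ => ?_, x.2⟩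
    exact Set.mem_iInter₂.1 hx χ hχ (by rw [← map_nsmul, hxp, map_zero])
  · refine ⟨F.card, fun p hp => ?_⟩
    have := Fact.mk hp
    let P := AddSubgroup.torsionBy K (p : ℤ)
    let T := {t : UnitAddCircle | p • t = 0}
    let R : P →+ (F → UnitAddCircle) := AddMonoidHom.mk' (fun x χ => χ.1 (x : K)) fun x y => by
      ext χ
      exact map_add χ.1 _ _
    have hTfin : Finite T := finite_circle_torsion hp.ne_zero
    have hTcard : Nat.card T ≤ p := by
      have h := AddCircle.card_torsion_le_of_isSMulRegular (1 : ℝ) p hp.ne_zero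
        (.of_right_eq_zero_of_smul fun _ ↦ by simp [hp.ne_zero])
      rw [Nat.card_coe_set_eq, Set.ncard_def]
      exact ENat.toNat_le_of_le_natCast h
    have hRT : Set.range R ⊆ Set.range (fun (g : F → T) χ => (g χ : UnitAddCircle)) := by
      rintro _ ⟨x, rfl⟩
      refine ⟨fun χ => ⟨χ.1 (x : K), ?_⟩, rfl⟩
      change p • χ.1 (x : K) = 0
      rw [← map_nsmul, mem_torsionBy_iff.1 x.2, map_zero]
    have hRfin : Finite R.range := (Set.finite_range _).subset hRT
    have hRcard : Nat.card R.range ≤ p ^ F.card := by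
      calc Nat.card R.range ≤ Nat.card (Set.range (fun (g : F → T) χ => (g χ : UnitAddCircle))) :=
            Nat.card_mono (Set.finite_range _) hRT
        _ ≤ Nat.card (F → T) := Finite.card_range_le _
        _ = Nat.card T ^ F.card := by rw [Nat.card_fun]; simp
        _ ≤ _ := Nat.pow_le_pow_left hTcard _
    have hker : R.ker ≤ G.pTorsionIn p := fun x hx =>
      ⟨hFG p hp x (mem_torsionBy_iff.1 x.2) fun χ hχ => congrFun hx ⟨χ, hχ⟩, x.2⟩
    have hker0 : R.ker.index ≠ 0 := by
      rw [AddSubgroup.index_ker]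
      exact Nat.card_pos.ne'
    have hdvd := AddSubgroup.index_dvd_of_le hker
    have hQ0 : (G.pTorsionIn p).index ≠ 0 := fun h0 => hker0 (by
      rw [h0] at hdvd; exact zero_dvd_iff.1 hdvd)
    have hQle : Nat.card (P ⧸ G.pTorsionIn p) ≤ p ^ F.card :=
      (Nat.le_of_dvd (Nat.pos_of_ne_zero hker0) hdvd).trans
        (by rw [AddSubgroup.index_ker]; exact hRcard)
    have hQfin : Finite (P ⧸ G.pTorsionIn p) := Nat.finite_of_card_ne_zero hQ0
    let _ : Module (ZMod p) (AddSubgroup.torsionBy (P ⧸ G.pTorsionIn p) (p : ℤ)) :=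
      AddSubgroup.torsionBy.zmodModule
    have hfinite : Module.Finite (ZMod p) (AddSubgroup.torsionBy (P ⧸ G.pTorsionIn p) (p : ℤ)) :=
      Module.Finite.of_finite
    change Module.rank (ZMod p) (AddSubgroup.torsionBy (P ⧸ G.pTorsionIn p) (p : ℤ)) ≤ _
    rw [← Module.finrank_eq_rank, Nat.cast_le, ← Nat.pow_le_pow_iff_right hp.one_lt]
    have hc := Module.natCard_eq_pow_finrank (K := ZMod p)
      (V := AddSubgroup.torsionBy (P ⧸ G.pTorsionIn p) (p : ℤ))
    rw [Nat.card_zmod] at hc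
    rw [← hc]
    exact (Nat.card_le_card_of_injective _ Subtype.val_injective).trans hQle

end LocalEssentiality

/-! ### Existence of `δ`-subgroups -/

section DeltaSubgroups

variable {K : Type u} [AddCommGroup K] [TopologicalSpace K] [IsTopologicalAddGroup K]
  [CompactSpace K] [T2Space K]

/-- Every closed totally disconnected subgroup is contained in a `δ`-subgroup. -/
theorem exists_isDeltaSubgroup_ge (N : AddSubgroup K) (hN : IsClosed (N : Set K))
    (hd : IsTotallyDisconnected (N : Set K)) : ∃ M : AddSubgroup K, M.IsDeltaSubgroup ∧ N ≤ M := by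
  let I := {χ : K →ₜ+ UnitAddCircle // ∀ x ∈ N, χ x = 0}
  let v : I → (K →ₜ+ UnitAddCircle) := Subtype.val
  -- Independence makes the map to the torus `s → UnitAddCircle` surjective; maximality makes its
  -- kernel totally disconnected.
  obtain ⟨s, hs, hmax⟩ := exists_maximal_linearIndepOn ℤ v
  let q : K →+ (s → UnitAddCircle) := AddMonoidHom.mk' (fun x i => v i x) fun x y => by
    ext i
    exact map_add (v i) _ _
  have hqc : Continuous q := continuous_pi fun i => (v i).continuous_toFun
  have hqs : Function.Surjective q := by
    intro g
    obtain ⟨h, hh⟩ := exists_hom_of_linearIndependent hs g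
    obtain ⟨x, hx⟩ := exists_eval_eq h
    exact ⟨x, funext fun i => (hx _).trans (hh i)⟩
  have hspan : ∀ χ ∈ Submodule.span ℤ (Set.image v s), ∀ x ∈ q.ker, χ x = 0 := by
    intro χ hχ x hx
    induction hχ using Submodule.span_induction with
    | mem χ hχ =>
      obtain ⟨i, hi, rfl⟩ := hχ
      exact congrFun hx ⟨i, hi⟩
    | zero => rfl
    | add χ ψ _ _ h1 h2 =>
      change χ x + ψ x = 0
      rw [h1, h2, add_zero]
    | smul n χ _ h1 =>
      change evalHom x (n • χ) = 0
      rw [map_zsmul]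
      change n • χ x = 0
      rw [h1, smul_zero]
  -- A multiple of `χ` annihilates `N`, and by maximality a further multiple lies in the span of
  -- `s`. So `χ` has finitely many values on the kernel.
  have hkill : ∀ χ : K →ₜ+ UnitAddCircle, ∃ m : ℤ, m ≠ 0 ∧ ∀ x ∈ q.ker, m • χ x = 0 := by
    intro χ
    obtain ⟨d, hd0, hdN⟩ := exists_nsmul_character_eq_zero χ N hN hd
    have heval : ∀ (m : ℤ) (ψ : K →ₜ+ UnitAddCircle) (x : K), (m • ψ) x = m • ψ x :=
      fun m ψ x => map_zsmul (evalHom x) m ψ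
    let i : I := ⟨(d : ℤ) • χ, fun x hx => by
      rw [heval, natCast_zsmul]; exact hdN x hx⟩
    by_cases hi : i ∈ s
    · refine ⟨d, by exact_mod_cast hd0, fun x hx => ?_⟩
      rw [← heval]
      exact hspan _ (Submodule.subset_span ⟨i, hi, rfl⟩) x hx
    · obtain ⟨a, ha0, ha⟩ := hmax i hi
      refine ⟨a * d, mul_ne_zero ha0 (by exact_mod_cast hd0), fun x hx => ?_⟩
      have := hspan _ ha x hx
      rwa [heval, heval, ← mul_smul] at this
  refine ⟨q.ker, ⟨?_, ?_, ?_⟩, fun x hx => funext fun i => i.1.2 x hx⟩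
  · exact (isClosed_singleton (x := (0 : s → UnitAddCircle))).preimage hqc
  · intro C hC hCp x hx y hy
    refine eq_of_forall_character fun χ => ?_
    obtain ⟨m, hm0, hm⟩ := hkill χ
    have hfin : (Set.image χ C).Finite := by
      refine (finite_circle_torsion (p := m.natAbs) (Int.natAbs_ne_zero.2 hm0)).subset ?_
      rintro _ ⟨z, hz, rfl⟩
      have h := hm z (hC hz)
      rcases Int.natAbs_eq m with hm' | hm'
      · rw [hm', natCast_zsmul] at h
        exact h
      · rw [hm', neg_smul, neg_eq_zero, natCast_zsmul] at h
        exact h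
    exact hfin.countable.isTotallyDisconnected _ subset_rfl
      (hCp.image χ χ.continuous_toFun.continuousOn) ⟨x, hx, rfl⟩ ⟨y, hy, rfl⟩
  · let e := QuotientAddGroup.quotientKerEquivOfSurjective q hqs
    have hec : Continuous e := by
      exact continuous_quot_lift _ hqc
    exact ⟨s, ⟨{ e with
      continuous_toFun := hec
      continuous_invFun := hec.continuous_symm_of_equiv_compact_to_t2 }⟩⟩

end DeltaSubgroups

end CompactAbelian

/-! ### Sperner's lemma for the Kuhn triangulation -/

namespace Sperner

open Finset

/-- The labels `0, …, m` all occur. -/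
def Full (m : ℕ) (l : Fin (m + 1) → ℕ) : Prop := ∀ c ≤ m, ∃ j, l j = c

/-- The labels `1, …, m` all occur. -/
def Door (m : ℕ) (l : Fin m → ℕ) : Prop := ∀ c, 1 ≤ c → c ≤ m → ∃ j, l j = c

theorem Door.injective {m : ℕ} {l : Fin m → ℕ} (h : Door m l) : Function.Injective l := by
  have h1 : Icc 1 m ⊆ univ.image l := fun c hc => by
    obtain ⟨j, hj⟩ := h c (mem_Icc.1 hc).1 (mem_Icc.1 hc).2
    exact mem_image.2 ⟨j, mem_univ j, hj⟩
  have h2 := card_le_card h1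
  rw [Nat.card_Icc, Nat.add_sub_cancel] at h2
  have h3 : (univ.image l).card = (univ : Finset (Fin m)).card :=
    le_antisymm card_image_le (by simpa using h2)
  exact Set.injOn_univ.1 (by simpa using card_image_iff.1 h3)

theorem Full.injective {m : ℕ} {l : Fin (m + 1) → ℕ} (h : Full m l) : Function.Injective l := by
  have h1 : range (m + 1) ⊆ univ.image l := fun c hc => by
    obtain ⟨j, hj⟩ := h c (by simpa [Nat.lt_succ_iff] using hc)
    exact mem_image.2 ⟨j, mem_univ j, hj⟩
  have h2 := card_le_card h1
  rw [card_range] at h2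
  have h3 : (univ.image l).card = (univ : Finset (Fin (m + 1))).card :=
    le_antisymm card_image_le (by simpa using h2)
  exact Set.injOn_univ.1 (by simpa using card_image_iff.1 h3)

/-- The indicator of a proposition, modulo two. -/
noncomputable def ind (P : Prop) : ZMod 2 :=
  open Classical in if P then 1 else 0

theorem ind_of {P : Prop} (h : P) : ind P = 1 := if_pos h

theorem ind_of_not {P : Prop} (h : ¬ P) : ind P = 0 := if_neg h

/-- The number of doors of a simplex is odd precisely when it carries all labels. -/
theorem sum_door (m : ℕ) (l : Fin (m + 1) → ℕ) (hl : ∀ j, l j ≤ m) :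
    ∑ k : Fin (m + 1), ind (Door m fun j => l (k.succAbove j)) =
      ind (Full m l) := by
  by_cases hfull : Full m l
  · rw [ind_of hfull]
    obtain ⟨k₀, hk₀⟩ := hfull 0 (Nat.zero_le m)
    -- The only door is the facet opposite the vertex labelled `0`.
    rw [Finset.sum_eq_single k₀]
    · refine ind_of fun c hc hcm => ?_
      obtain ⟨j, hj⟩ := hfull c hcm
      obtain ⟨i, hi⟩ := Fin.exists_succAbove_eq (x := j) (y := k₀) (by
        rintro rfl
        omega)
      exact ⟨i, by simp only [hi, hj]⟩
    · intro k _ hk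
      refine ind_of_not fun hd => ?_
      have hlk : 1 ≤ l k := by
        rcases Nat.eq_zero_or_pos (l k) with h | h
        · exact absurd (hfull.injective (h.trans hk₀.symm)) hk
        · exact h
      obtain ⟨j, hj⟩ := hd (l k) hlk (hl k)
      exact Fin.succAbove_ne k j (hfull.injective hj)
    · simp
  · rw [ind_of_not hfull]
    by_cases hall : ∀ c, 1 ≤ c → c ≤ m → ∃ j, l j = c
    · have hz : ∀ j, l j ≠ 0 := by
        intro j hj
        refine hfull fun c hc => ?_
        rcases Nat.eq_zero_or_pos c with h | h
        · exact ⟨j, hj.trans h.symm⟩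
        · exact hall c h hc
      -- With labels exactly `1, …, m` on `m + 1` vertices, one label is repeated; the two facets
      -- opposite its vertices are the only doors and cancel.
      obtain ⟨a, b, hab, hlab⟩ : ∃ a b, a ≠ b ∧ l a = l b := by
        have hmaps : ∀ j ∈ (univ : Finset (Fin (m + 1))), l j ∈ Icc 1 m := fun j _ =>
          mem_Icc.2 ⟨Nat.pos_of_ne_zero (hz j), hl j⟩
        obtain ⟨a, -, b, -, h1, h2⟩ := exists_ne_map_eq_of_card_lt_of_maps_to (by simp) hmaps
        exact ⟨a, b, h1, h2⟩
      have hdoor : ∀ a b, a ≠ b → l a = l b → Door m (fun j => l (a.succAbove j)) := by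
        intro a b hab hlab c hc hcm
        obtain ⟨j, hj⟩ := hall c hc hcm
        by_cases hja : j = a
        · obtain ⟨i, hi⟩ := Fin.exists_succAbove_eq hab.symm
          exact ⟨i, by simp only [hi]; rw [← hlab, ← hja, hj]⟩
        · obtain ⟨i, hi⟩ := Fin.exists_succAbove_eq hja
          exact ⟨i, by simp only [hi, hj]⟩
      have hnot : ∀ k, k ≠ a → k ≠ b → ¬ Door m (fun j => l (k.succAbove j)) := by
        intro k hka hkb hd
        obtain ⟨i, hi⟩ := Fin.exists_succAbove_eq hka.symm
        obtain ⟨j, hj⟩ := Fin.exists_succAbove_eq hkb.symm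
        have : i = j := hd.injective (by simp only [hi, hj, hlab])
        exact hab (by rw [← hi, ← hj, this])
      rw [← Finset.sum_subset (subset_univ ({a, b} : Finset (Fin (m + 1))))]
      · rw [sum_pair hab, ind_of (hdoor a b hab hlab), ind_of (hdoor b a hab.symm hlab.symm)]
        decide
      · intro k _ hk
        simp only [mem_insert, mem_singleton, not_or] at hk
        exact ind_of_not (hnot k hk.1 hk.2)
    · push Not at hall
      obtain ⟨c, hc, hcm, hcj⟩ := hall
      refine Finset.sum_eq_zero fun k _ => ind_of_not fun hd => ?_
      obtain ⟨j, hj⟩ := hd c hc hcm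
      exact hcj _ hj

/-- The `j`-th vertex, from the top, of the simplex of the Kuhn triangulation with bottom vertex
`x` in which the direction `i` is removed after the `ρ i`-th vertex. -/
def vertex {m : ℕ} (ρ : Equiv.Perm (Fin m)) (x : Fin m → ℕ) (j : ℕ) : Fin m → ℕ :=
  fun i => x i + if j ≤ (ρ i : ℕ) then 1 else 0

/-- The bottom vertices of the simplices of a grid of side `N`. -/
def box (m N : ℕ) : Finset (Fin m → ℕ) := Fintype.piFinset fun _ => range N

theorem mem_box {m N : ℕ} {x : Fin m → ℕ} : x ∈ box m N ↔ ∀ i, x i < N := by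
  simp [box]

theorem vertex_le {m N : ℕ} (ρ : Equiv.Perm (Fin m)) {x : Fin m → ℕ} (hx : x ∈ box m N) (j : ℕ)
    (i : Fin m) : vertex ρ x j i ≤ N := by
  have := mem_box.1 hx i
  unfold vertex
  split_ifs <;> omega

/-- Summing over a grid the differences in one direction. -/
theorem sum_box_telescope {m N : ℕ} (i : Fin m) (h : (Fin m → ℕ) → ZMod 2)
    (h0 : ∀ x, (∀ i' ≠ i, x i' < N) → x i = N → h x = 0) :
    ∑ x ∈ box m N, (h (x + Pi.single i 1) + h x) = ∑ x ∈ box m N with x i = 0, h x := by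
  rw [sum_add_distrib]
  have h1 : ∑ x ∈ box m N, h (x + Pi.single i 1) = ∑ x ∈ box m N with ¬ x i = 0, h x := by
    have hle : ∀ x ∈ box m N, ∀ i' ≠ i, (x + Pi.single i 1 : Fin m → ℕ) i' < N := by
      intro x hx i' hi'
      have := mem_box.1 hx i'
      simpa [hi'] using this
    have h2 : ∑ x ∈ box m N, h (x + Pi.single i 1) =
        ∑ x ∈ box m N with x i + 1 < N, h (x + Pi.single i 1) := by
      rw [sum_filter_of_ne]
      intro x hx hne
      by_contra hlt
      refine hne (h0 _ (hle x hx) ?_)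
      have := mem_box.1 hx i
      simp
      omega
    rw [h2]
    refine sum_bij' (fun x _ => x + Pi.single i 1) (fun x _ => x - Pi.single i 1) ?_ ?_ ?_ ?_ ?_
    · intro x hx
      rw [mem_filter, mem_box] at hx ⊢
      refine ⟨fun i' => ?_, by simp⟩
      by_cases hi : i' = i
      · subst hi
        simpa using hx.2
      · simpa [Pi.single_apply, hi] using hx.1 i'
    · intro x hx
      rw [mem_filter, mem_box] at hx ⊢
      refine ⟨fun i' => ?_, ?_⟩
      · exact lt_of_le_of_lt (Nat.sub_le _ _) (hx.1 i')
      · have := hx.1 i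
        simp
        omega
    · intro x hx
      ext i'
      simp
    · intro x hx
      rw [mem_filter] at hx
      ext i'
      by_cases hi : i' = i
      · subst hi
        simp
        omega
      · simp [hi]
    · intro x hx
      rfl
  rw [h1, ← sum_filter_add_sum_filter_not (box m N) (fun x => x i = 0) h, add_comm, add_assoc,
    CharTwo.add_self_eq_zero, add_zero]

/-- A labelling of the grid of side `N` by `0, …, m` as in the Sperner lemma. -/
structure Labelling (m N : ℕ) (lam : (Fin m → ℕ) → ℕ) : Prop where
  le : ∀ x, (∀ i, x i ≤ N) → lam x ≤ m
  bottom : ∀ x, (∀ i, x i ≤ N) → ∀ i : Fin m, x i = 0 → (i : ℕ) + 1 ≤ lam x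
  top : ∀ x, (∀ i, x i ≤ N) → ∀ i : Fin m, x i = N → lam x ≠ (i : ℕ) + 1

/-- On the face where the first coordinate is `0` all labels are at least `1`, so lowering them by
one gives the induction. -/
theorem Labelling.face {m N : ℕ} {lam : (Fin (m + 1) → ℕ) → ℕ} (h : Labelling (m + 1) N lam) :
    Labelling m N (fun y => lam (Fin.cons 0 y) - 1) := by
  have hle : ∀ y : Fin m → ℕ, (∀ i, y i ≤ N) →
      ∀ i, (Fin.cons 0 y : Fin (m + 1) → ℕ) i ≤ N := by
    intro y hy i
    refine Fin.cases ?_ (fun i => ?_) i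
    · simp
    · simpa using hy i
  refine ⟨fun y hy => ?_, fun y hy i hi => ?_, fun y hy i hi => ?_⟩
  · have := h.le _ (hle y hy)
    omega
  · have := h.bottom _ (hle y hy) i.succ (by simpa using hi)
    simp at this
    omega
  · have := h.top _ (hle y hy) i.succ (by simpa using hi)
    have h' := h.bottom _ (hle y hy) 0 (by simp)
    simp at this h'
    omega

/-- Exchanging two consecutive directions changes only the vertex between them: two simplices share
this interior facet. -/
theorem vertex_swap {m : ℕ} (ρ : Equiv.Perm (Fin m)) (x : Fin m → ℕ) {a b : Fin m}
    (hab : (a : ℕ) + 1 = b) {j : ℕ} (hj : j ≠ b) :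
    vertex (Equiv.swap a b * ρ) x j = vertex ρ x j := by
  ext i
  have : (j ≤ ((Equiv.swap a b * ρ) i : ℕ)) ↔ j ≤ (ρ i : ℕ) := by
    rw [Equiv.Perm.mul_apply, Equiv.swap_apply_def]
    split_ifs with h1 h2
    · rw [h1]; omega
    · rw [h2]; omega
    · rfl
  simp only [vertex, this]

/-- The facet without the bottom vertex is the facet without the top vertex of the next simplex, one
step along the direction removed last. -/
theorem vertex_rotate {m : ℕ} (ρ : Equiv.Perm (Fin (m + 1))) (x : Fin (m + 1) → ℕ) {j : ℕ}
    (hj : j ≤ m) :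
    vertex (finRotate (m + 1) * ρ) (x + Pi.single ((finRotate (m + 1) * ρ).symm 0) 1) (j + 1) =
      vertex ρ x j := by
  ext i
  by_cases hi : i = (finRotate (m + 1) * ρ).symm 0
  · have h1 : (finRotate (m + 1) * ρ) i = 0 := by rw [hi, Equiv.apply_symm_apply]
    have h2 : ρ i = Fin.last m := by
      rw [Equiv.Perm.mul_apply] at h1
      apply (finRotate (m + 1)).injective
      rw [h1, finRotate_last]
    simp only [vertex, h1, h2]
    rw [Pi.add_apply, ← hi]
    simp [hj]
  · have h1 : (finRotate (m + 1) * ρ) i ≠ 0 := fun h => hi (by rw [← h, Equiv.symm_apply_apply])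
    have h2 : ρ i ≠ Fin.last m := fun h => h1 (by rw [Equiv.Perm.mul_apply, h, finRotate_last])
    have h3 : ((finRotate (m + 1) * ρ) i : ℕ) = ρ i + 1 := by
      rw [Equiv.Perm.mul_apply]
      exact coe_finRotate_of_ne_last h2
    simp only [vertex, h3, Pi.add_apply, Pi.single_apply, if_neg hi, add_zero,
      Nat.add_le_add_iff_right]

/-- If direction `0` is removed first, the facet without the top vertex is a Kuhn simplex of the
face where coordinate `0` vanishes. -/
theorem vertex_decomposeFin {m : ℕ} (e : Equiv.Perm (Fin m)) (y : Fin m → ℕ) (j : ℕ) :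
    vertex (Equiv.Perm.decomposeFin.symm (0, e)) (Fin.cons 0 y : Fin (m + 1) → ℕ) (j + 1) =
      Fin.cons 0 (vertex e y j) := by
  ext i
  refine Fin.cases ?_ (fun i => ?_) i
  · simp [vertex]
  · simp [vertex]

/-- **The Sperner lemma** for the Kuhn triangulation of a cube. -/
theorem sum_full (m N : ℕ) (hN : 0 < N) : ∀ lam : (Fin m → ℕ) → ℕ, Labelling m N lam →
    ∑ ρ : Equiv.Perm (Fin m), ∑ x ∈ box m N,
      ind (Full m fun j => lam (vertex ρ x j)) = 1 := by
  induction m with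
  | zero =>
    intro lam hlam
    have hb : box 0 N = {fun i => i.elim0} := by
      ext x
      simp only [mem_box, mem_singleton]
      exact ⟨fun _ => Subsingleton.elim _ _, fun _ i => i.elim0⟩
    rw [hb]
    simp only [sum_singleton]
    rw [Fintype.sum_unique, ind_of]
    intro c hc
    refine ⟨0, ?_⟩
    have := hlam.le (vertex default (fun i => i.elim0) ((0 : Fin 1) : ℕ)) fun i => i.elim0
    exact (Nat.le_zero.1 this).trans (Nat.le_zero.1 hc).symm
  | succ m ih =>
    intro lam hlam
    let C : Equiv.Perm (Fin (m + 1)) → (Fin (m + 1) → ℕ) → ZMod 2 := fun ρ x =>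
      ind (Door (m + 1) fun j => lam (vertex ρ x (j + 1)))
    let D : Fin (m + 2) → Equiv.Perm (Fin (m + 1)) → ZMod 2 := fun k ρ => ∑ x ∈ box (m + 1) N,
      ind (Door (m + 1) fun j => lam (vertex ρ x (k.succAbove j)))
    -- Facets opposite intermediate vertices cancel in pairs.
    have hmid : ∀ k : Fin m, ∑ ρ, D k.castSucc.succ ρ = 0 := by
      intro k
      refine sum_involution (fun ρ _ => Equiv.swap k.castSucc k.succ * ρ) ?_ ?_ ?_ ?_
      · intro ρ _
        have : D k.castSucc.succ (Equiv.swap k.castSucc k.succ * ρ) = D k.castSucc.succ ρ := by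
          simp only [D]
          refine sum_congr rfl fun x _ => ?_
          have h : ∀ j, vertex (Equiv.swap k.castSucc k.succ * ρ) x
              (k.castSucc.succ.succAbove j : Fin (m + 2)) =
              vertex ρ x (k.castSucc.succ.succAbove j : Fin (m + 2)) := fun j =>
            vertex_swap ρ x (by simp) (by
              intro h
              exact Fin.succAbove_ne k.castSucc.succ j (Fin.ext (by rw [h]; simp)))
          simp only [h]
        rw [this, CharTwo.add_self_eq_zero]
      · intro ρ _ _ h
        have := mul_eq_right.1 h
        rw [Equiv.swap_eq_one_iff] at this
        exact absurd this (Fin.castSucc_lt_succ (i := k)).ne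
      · intro ρ _
        exact mem_univ _
      · intro ρ _
        rw [← mul_assoc, Equiv.swap_mul_self, one_mul]
    have htop : ∀ ρ, D 0 ρ = ∑ x ∈ box (m + 1) N, C ρ x := by
      intro ρ
      simp [D, C]
    have hbot : ∑ ρ, D (Fin.last (m + 1)) ρ =
        ∑ ρ, ∑ x ∈ box (m + 1) N, C ρ (x + Pi.single (ρ.symm 0) 1) := by
      refine Eq.trans ?_ (Equiv.sum_comp (Equiv.mulLeft (finRotate (m + 1)))
        (fun ρ : Equiv.Perm (Fin (m + 1)) =>
          ∑ x ∈ box (m + 1) N, C ρ (x + Pi.single (ρ.symm 0) 1)))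
      refine sum_congr rfl fun ρ _ => sum_congr rfl fun x _ => ?_
      simp only [C, Equiv.coe_mulLeft]
      have h : ∀ j : Fin (m + 1), vertex (finRotate (m + 1) * ρ)
          (x + Pi.single ((finRotate (m + 1) * ρ).symm 0) 1) ((j : ℕ) + 1) =
          vertex ρ x ((Fin.last (m + 1)).succAbove j : Fin (m + 2)) := fun j => by
        rw [vertex_rotate ρ x (Nat.lt_succ_iff.1 j.2)]
        simp
      simp only [h]
    -- Top and bottom facets cancel along each direction. What is left lies on the low face, since
    -- on the high face in direction `i` the label `i + 1` is missing.
    have htel : ∀ ρ : Equiv.Perm (Fin (m + 1)),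
        ∑ x ∈ box (m + 1) N, (C ρ (x + Pi.single (ρ.symm 0) 1) + C ρ x) =
        ∑ x ∈ box (m + 1) N with x (ρ.symm 0) = 0, C ρ x := by
      intro ρ
      refine sum_box_telescope _ _ fun x hx hxN => ind_of_not fun hd => ?_
      obtain ⟨j, hj⟩ := hd ((ρ.symm 0 : ℕ) + 1) (by omega) (ρ.symm 0).2
      refine hlam.top _ (fun i => ?_) (ρ.symm 0) ?_ hj
      · by_cases hi : i = ρ.symm 0
        · rw [hi]
          simp [vertex, hxN]
        · have := hx i hi
          unfold vertex
          split_ifs <;> omega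
      · simp [vertex, hxN]
    -- On a low face in a direction other than `0` every label is at least `2`, so there are no
    -- doors.
    have hface : ∀ (p : Fin (m + 1)) (e : Equiv.Perm (Fin m)), p ≠ 0 →
        ∑ x ∈ box (m + 1) N with x ((Equiv.Perm.decomposeFin.symm (p, e)).symm 0) = 0,
          C (Equiv.Perm.decomposeFin.symm (p, e)) x = 0 := by
      intro p e hp
      set ρ := Equiv.Perm.decomposeFin.symm (p, e) with hρ
      have hne : ρ.symm 0 ≠ 0 := by
        intro h
        rw [Equiv.symm_apply_eq, hρ, Equiv.Perm.decomposeFin_symm_apply_zero] at h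
        exact hp h.symm
      refine sum_eq_zero fun x hx => ind_of_not fun hd => ?_
      rw [mem_filter] at hx
      obtain ⟨j, hj⟩ := hd 1 le_rfl (by omega)
      have := hlam.bottom _ (vertex_le ρ hx.1 (j + 1)) (ρ.symm 0) (by simp [vertex, hx.2])
      simp only at hj
      rw [hj] at this
      exact hne (Fin.ext (by simpa using this))
    have hzero : ∀ e : Equiv.Perm (Fin m),
        ∑ x ∈ box (m + 1) N with x ((Equiv.Perm.decomposeFin.symm (0, e)).symm 0) = 0,
          C (Equiv.Perm.decomposeFin.symm (0, e)) x =
        ∑ y ∈ box m N, ind (Full m fun j => lam (Fin.cons 0 (vertex e y j)) - 1) := by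
      intro e
      have h0 : (Equiv.Perm.decomposeFin.symm (0, e)).symm 0 = 0 := by
        rw [Equiv.symm_apply_eq, Equiv.Perm.decomposeFin_symm_apply_zero]
      rw [h0]
      refine sum_bij' (fun x _ => Fin.tail x) (fun y _ => Fin.cons 0 y) ?_ ?_ ?_ ?_ ?_
      · intro x hx
        rw [mem_filter, mem_box] at hx
        exact mem_box.2 fun i => hx.1 i.succ
      · intro y hy
        rw [mem_filter, mem_box]
        refine ⟨fun i => Fin.cases (by simpa using hN) (fun i => ?_) i, by simp⟩
        simpa using mem_box.1 hy i
      · intro x hx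
        rw [mem_filter] at hx
        rw [← hx.2]
        exact Fin.cons_self_tail x
      · intro y hy
        exact Fin.tail_cons _ _
      · intro x hx
        rw [mem_filter] at hx
        have hx' : x = Fin.cons 0 (Fin.tail x) := by
          rw [← hx.2]
          exact (Fin.cons_self_tail x).symm
        have hbox : Fin.tail x ∈ box m N := mem_box.2 fun i => mem_box.1 hx.1 i.succ
        have hv : ∀ j : ℕ, vertex (Equiv.Perm.decomposeFin.symm (0, e)) x (j + 1) =
            Fin.cons 0 (vertex e (Fin.tail x) j) := fun j => by
          conv_lhs => rw [hx']
          exact vertex_decomposeFin e _ j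
        simp only [C, hv]
        congr 1
        have hpos : ∀ j : ℕ, 1 ≤ lam (Fin.cons 0 (vertex e (Fin.tail x) j)) := by
          intro j
          refine hlam.bottom _ (fun i => ?_) 0 (by simp)
          refine Fin.cases (by simp) (fun i => ?_) i
          simpa using vertex_le e hbox j i
        refine propext ⟨fun h c hc => ?_, fun h c h1 hc => ?_⟩
        · obtain ⟨j, hj⟩ := h (c + 1) (by omega) (by omega)
          simp only at hj
          exact ⟨j, by simp only; omega⟩
        · obtain ⟨j, hj⟩ := h (c - 1) (by omega)
          have := hpos j
          simp only at hj
          exact ⟨j, by simp only; omega⟩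
    calc ∑ ρ : Equiv.Perm (Fin (m + 1)), ∑ x ∈ box (m + 1) N,
          ind (Full (m + 1) fun j => lam (vertex ρ x j))
        = ∑ ρ, ∑ k, D k ρ := by
          refine sum_congr rfl fun ρ _ => ?_
          rw [sum_comm]
          refine sum_congr rfl fun x hx => ?_
          exact (sum_door (m + 1) (fun j => lam (vertex ρ x j)) fun j =>
            hlam.le _ (vertex_le ρ hx j)).symm
      _ = ∑ k, ∑ ρ, D k ρ := sum_comm
      _ = ∑ ρ, D 0 ρ + ∑ ρ, D (Fin.last (m + 1)) ρ := by
          rw [Fin.sum_univ_succ, Fin.sum_univ_castSucc]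
          simp only [hmid, sum_const_zero, zero_add, Fin.succ_last]
      _ = ∑ ρ : Equiv.Perm (Fin (m + 1)),
          ∑ x ∈ box (m + 1) N with x (ρ.symm 0) = 0, C ρ x := by
          rw [hbot, add_comm, ← sum_add_distrib]
          refine sum_congr rfl fun ρ _ => ?_
          rw [htop, ← sum_add_distrib, htel]
      _ = ∑ e : Equiv.Perm (Fin m), ∑ y ∈ box m N,
          ind (Full m fun j => lam (Fin.cons 0 (vertex e y j)) - 1) := by
          rw [← Equiv.sum_comp Equiv.Perm.decomposeFin.symm, Fintype.sum_prod_type,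
            Fintype.sum_eq_single 0]
          · exact sum_congr rfl fun e _ => hzero e
          · exact fun p hp => sum_eq_zero fun e _ => hface p e hp
      _ = 1 := ih _ hlam.face

theorem exists_full {m N : ℕ} (hN : 0 < N) {lam : (Fin m → ℕ) → ℕ} (h : Labelling m N lam) :
    ∃ ρ : Equiv.Perm (Fin m), ∃ x ∈ box m N, Full m fun j => lam (vertex ρ x j) := by
  by_contra! hne
  have := sum_full m N hN lam h
  rw [sum_eq_zero fun ρ _ => sum_eq_zero fun x hx => ind_of_not (hne ρ x hx)] at this
  exact zero_ne_one this

end Sperner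

namespace CompactAbelian

open Filter Topology

/-! ### Covering dimension and independent characters -/

section Dimension

variable {K : Type u} [AddCommGroup K] [TopologicalSpace K] [IsTopologicalAddGroup K]
  [CompactSpace K] [T2Space K]

/-- Independent characters can be lifted to a multi-parameter subgroup. -/
theorem exists_continuous_lift {m : ℕ} {χ : Fin m → (K →ₜ+ UnitAddCircle)}
    (hχ : LinearIndependent ℤ χ) :
    ∃ ψ : (Fin m → ℝ) → K, Continuous ψ ∧
      ∀ t i, χ i (ψ t) = ((t i / 2 : ℝ) : UnitAddCircle) := by
  -- The value `1 / 2` sends the opposite faces `t i = 0` and `t i = 1` to distinct points of the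
  -- circle.
  choose f hf using fun i : Fin m =>
    exists_hom_of_linearIndependent (D := ℝ) hχ (fun j => if i = j then 1 / 2 else 0)
  have hex : ∀ t : Fin m → ℝ, ∃ x : K, ∀ ρ : K →ₜ+ UnitAddCircle,
      ρ x = ((∑ i, t i * f i ρ : ℝ) : UnitAddCircle) := by
    intro t
    refine exists_eval_eq (AddMonoidHom.mk'
      (fun ρ => ((∑ i, t i * f i ρ : ℝ) : UnitAddCircle)) fun ρ σ => ?_)
    rw [← AddCircle.coe_add, ← Finset.sum_add_distrib]
    simp only [map_add, mul_add]
  choose ψ hψ using hex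
  refine ⟨ψ, continuous_of_forall_character fun ρ => ?_, fun t i => ?_⟩
  · simp only [hψ]
    exact (AddCircle.continuous_mk' 1).comp (by fun_prop)
  · rw [hψ]
    simp [hf, div_eq_mul_inv]

/-- **The covering theorem of Lebesgue**: if a cube is covered by finitely many open sets none of
which
meets two opposite faces, then some point lies in more sets than the dimension of the cube. -/
theorem exists_lt_ncard_of_cube_cover {m r : ℕ} (hm : 0 < m) (V : Fin r → Set (Fin m → ℝ))
    (hV : ∀ j, IsOpen (V j)) (hcov : (⋃ j, V j) = Set.univ) (b : Fin r → Fin m → Prop)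
    (hb : ∀ j i t, t ∈ V j → b j i → t i ≠ 1) (hb' : ∀ j i t, t ∈ V j → ¬ b j i → t i ≠ 0) :
    ∃ t, m < {j | t ∈ V j}.ncard := by
  classical
  let I : Set (Fin m → ℝ) := Set.pi Set.univ fun _ => Set.Icc 0 1
  have hI : IsCompact I := isCompact_univ_pi fun _ => isCompact_Icc
  obtain ⟨δ, hδ, hleb⟩ := lebesgue_number_lemma_of_metric hI hV
    (by rw [hcov]; exact Set.subset_univ _)
  obtain ⟨N', hN'⟩ := exists_nat_one_div_lt hδ
  let N := N' + 1
  have hN0 : (0 : ℝ) < N := by positivity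
  have hNδ : 1 / (N : ℝ) < δ := by simpa [N] using hN'
  let pt : (Fin m → ℕ) → (Fin m → ℝ) := fun x i => x i / N
  have hpt : ∀ x : Fin m → ℕ, (∀ i, x i ≤ N) → pt x ∈ I := by
    intro x hx i _
    refine ⟨by positivity, (div_le_one hN0).2 (by exact_mod_cast hx i)⟩
  have hex : ∀ x : Fin m → ℕ, ∃ j, (∀ i, x i ≤ N) → Metric.ball (pt x) δ ⊆ V j := by
    intro x
    by_cases hx : ∀ i, x i ≤ N
    · obtain ⟨j, hj⟩ := hleb (pt x) (hpt x hx)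
      exact ⟨j, fun _ => hj⟩
    · obtain ⟨j, -⟩ := Set.mem_iUnion.1 (hcov.symm ▸ Set.mem_univ (0 : Fin m → ℝ))
      exact ⟨j, fun h => absurd h hx⟩
  choose J hJ using hex
  have hmemJ : ∀ x : Fin m → ℕ, (∀ i, x i ≤ N) → pt x ∈ V (J x) := fun x hx =>
    hJ x hx (Metric.mem_ball_self hδ)
  -- The label is the largest `i + 1` with `b j i`, or `0` if there is none. It depends only on the
  -- set, so different labels mean different sets.
  let lab : Fin r → ℕ := fun j => Finset.univ.sup fun i : Fin m => if b j i then (i : ℕ) + 1 else 0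
  have hlab : Sperner.Labelling m N (fun x => lab (J x)) := by
    refine ⟨fun x hx => Finset.sup_le fun i _ => ?_, fun x hx i hi => ?_, fun x hx i hi => ?_⟩
    · have := i.2
      split_ifs <;> omega
    · have hbi : b (J x) i := by
        by_contra hn
        exact hb' _ i _ (hmemJ x hx) hn (by simp [pt, hi])
      have := Finset.le_sup (f := fun i : Fin m => if b (J x) i then (i : ℕ) + 1 else 0)
        (Finset.mem_univ i)
      simpa only [hbi, if_true] using this
    · intro heq
      have hbi : ¬ b (J x) i := fun hn => hb _ i _ (hmemJ x hx) hn (by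
        simp only [pt, hi]
        exact div_self hN0.ne')
      obtain ⟨i', -, hi'⟩ := Finset.exists_mem_eq_sup (Finset.univ : Finset (Fin m))
        ⟨⟨0, hm⟩, Finset.mem_univ _⟩ (fun i : Fin m => if b (J x) i then (i : ℕ) + 1 else 0)
      simp only [lab] at heq
      rw [heq] at hi'
      split_ifs at hi' with h
      have : i = i' := Fin.ext (by omega)
      exact hbi (this ▸ h)
  obtain ⟨ρ, x, hx, hfull⟩ := Sperner.exists_full (Nat.succ_pos N') hlab
  refine ⟨pt x, ?_⟩
  -- The mesh `1 / N` is below the Lebesgue number, so the sets chosen at all the vertices contain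
  -- `pt x`.
  have hmem : ∀ k : Fin (m + 1), pt x ∈ V (J (Sperner.vertex ρ x k)) := by
    intro k
    refine hJ _ (Sperner.vertex_le ρ hx k) ?_
    rw [Metric.mem_ball, dist_pi_lt_iff hδ]
    intro i
    refine lt_of_le_of_lt ?_ hNδ
    rw [Real.dist_eq]
    simp only [pt, Sperner.vertex]
    split_ifs
    · rw [← sub_div, abs_div, abs_of_pos hN0]
      simp
    · simp [hN0.le]
  have hinj : Function.Injective fun k : Fin (m + 1) => J (Sperner.vertex ρ x k) := fun k l hkl =>
    hfull.injective (congrArg lab hkl)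
  calc m < (Set.range fun k : Fin (m + 1) => J (Sperner.vertex ρ x k)).ncard := by
        rw [← Set.image_univ, Set.ncard_image_of_injective _ hinj, Set.ncard_univ]
        simp
    _ ≤ _ := by
        refine Set.ncard_le_ncard ?_ (Set.toFinite _)
        rintro _ ⟨k, rfl⟩
        exact hmem k

theorem coe_half_ne_zero : ((1 / 2 : ℝ) : UnitAddCircle) ≠ 0 := by
  intro h
  have h2 := AddCircle.addOrderOf_period_div (p := (1 : ℝ)) (n := 2) (by norm_num)
  rw [Nat.cast_ofNat, h, addOrderOf_zero] at h2
  norm_num at h2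

/-- The number of independent characters is bounded in terms of the covering dimension. -/
theorem CoveringDimLE.not_linearIndependent {n : ℕ} (h : CoveringDimLE K n)
    (χ : Fin (n + 1) → (K →ₜ+ UnitAddCircle)) : ¬ LinearIndependent ℤ χ := by
  intro hχ
  obtain ⟨ψ, hψ, hψχ⟩ := exists_continuous_lift hχ
  let e := Fintype.equivFin (Fin (n + 1) → Bool)
  let c : Bool → UnitAddCircle := fun b => if b then ((1 / 2 : ℝ) : UnitAddCircle) else 0
  have hc : c true ≠ c false := by simpa [c] using coe_half_ne_zero
  -- Each covering set excludes, for every `i`, one of the two values taken by `χ i` on opposite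
  -- faces; so no refining set pulls back to meet both.
  obtain ⟨r, V, hVo, hVc, hVU, hVn⟩ := h _ (fun k => ⋂ i, {y | χ i y ≠ c (e.symm k i)})
    (fun k => isOpen_iInter_of_finite fun i =>
      isOpen_ne_fun (χ i).continuous_toFun continuous_const)
    (by
      refine Set.eq_univ_of_forall fun y => Set.mem_iUnion.2 ?_
      have : ∀ i, ∃ b, χ i y ≠ c b := fun i => by
        by_contra! hi
        exact hc ((hi true).symm.trans (hi false))
      choose b hb using this
      refine ⟨e b, Set.mem_iInter.2 fun i => ?_⟩
      simpa using hb i)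
  choose k hk using hVU
  obtain ⟨t, ht⟩ := exists_lt_ncard_of_cube_cover (Nat.succ_pos n) (fun j => ψ ⁻¹' V j)
    (fun j => (hVo j).preimage hψ) (by rw [← Set.preimage_iUnion, hVc, Set.preimage_univ])
    (fun j i => e.symm (k j) i = true)
    (fun j i t ht hb h1 => Set.mem_iInter.1 (hk j ht) i (by rw [hψχ, h1, hb]; simp [c]))
    (fun j i t ht hb h0 => Set.mem_iInter.1 (hk j ht) i (by
      rw [hψχ, h0, Bool.eq_false_of_not_eq_true hb]; simp [c]))
  exact absurd (hVn (ψ t)) (not_le.2 ht)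

/-- A group of finite covering dimension has no infinite-dimensional torus quotients. -/
theorem finite_of_finiteCoveringDim (h : FiniteCoveringDim K) {ι : Type*}
    (q : K →+ (ι → UnitAddCircle)) (hq : Continuous q) (hs : Function.Surjective q) :
    Finite ι := by
  classical
  obtain ⟨n, hn⟩ := h
  by_contra hinf
  rw [not_finite_iff_infinite] at hinf
  let e : Fin (n + 1) ↪ ι := (Fin.valEmbedding).trans (Infinite.natEmbedding ι)
  let χ : Fin (n + 1) → (K →ₜ+ UnitAddCircle) := fun i =>
    ContinuousAddMonoidHom.mk ((Pi.evalAddMonoidHom (fun _ : ι => UnitAddCircle) (e i)).comp q)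
      ((continuous_apply (e i)).comp hq)
  refine CoveringDimLE.not_linearIndependent hn χ (Fintype.linearIndependent_iff.2 fun g hg i => ?_)
  -- A point of this order in coordinate `i` is killed by `g i` only if `g i = 0`.
  let N := (g i).natAbs + 1
  let t : UnitAddCircle := ((1 / N : ℝ) : UnitAddCircle)
  have ht : addOrderOf t = N := AddCircle.addOrderOf_period_div (Nat.succ_pos _)
  obtain ⟨x, hx⟩ := hs (Pi.single (e i) t)
  have hval : ∀ j, χ j x = if j = i then t else 0 := by
    intro j
    change q x (e j) = _
    rw [hx, Pi.single_apply]
    simp only [e.injective.eq_iff]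
  have h1 := congrArg (evalHom x) hg
  rw [map_sum, map_zero] at h1
  have h2 : ∀ j, evalHom x (g j • χ j) = if j = i then g i • t else 0 := by
    intro j
    rw [map_zsmul]
    change g j • χ j x = _
    rw [hval]
    split_ifs with hj
    · rw [hj]
    · exact smul_zero _
  simp only [h2, Finset.sum_ite_eq', Finset.mem_univ, if_true] at h1
  rw [← addOrderOf_dvd_iff_zsmul_eq_zero, ht] at h1
  refine Int.eq_zero_of_abs_lt_dvd h1 ?_
  rw [Int.abs_eq_natAbs]
  simp [N]

end Dimension

/-! ### Passage between `K`, its closed socle and `δ`-subgroups -/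

section Main

variable {K : Type u} [AddCommGroup K] [TopologicalSpace K] [IsTopologicalAddGroup K]

theorem pTorsionOpen_comap {L : Type*} [AddCommGroup L] [TopologicalSpace L] (f : L →+ K)
    (hf : Continuous f) {G : AddSubgroup K} (hG : G.PTorsionOpen) : (G.comap f).PTorsionOpen := by
  intro p hp
  let F : AddSubgroup.torsionBy L (p : ℤ) → AddSubgroup.torsionBy K (p : ℤ) := fun x =>
    ⟨f x, mem_torsionBy_iff.2 (by rw [← map_nsmul, mem_torsionBy_iff.1 x.2, map_zero])⟩
  have hF : Continuous F := Continuous.subtype_mk (hf.comp continuous_subtype_val) _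
  convert (hG p hp).preimage hF using 1
  ext x
  exact ⟨fun h => ⟨h.1, (F x).2⟩, fun h => ⟨h.1, x.2⟩⟩

theorem mem_closedSocle {p : ℕ} (hp : p.Prime) {x : K} (hx : p • x = 0) :
    x ∈ AddSubgroup.closedSocle K := by
  refine AddSubgroup.le_topologicalClosure _ ?_
  exact le_iSup (fun p : Nat.Primes => AddSubgroup.torsionBy K ((p : ℕ) : ℤ)) ⟨p, hp⟩
    (mem_torsionBy_iff.2 hx)

variable [CompactSpace K] [T2Space K]

instance : CompactSpace (AddSubgroup.closedSocle K) :=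
  isCompact_iff_compactSpace.1 (AddSubgroup.isClosed_topologicalClosure _).isCompact

/-- Under `δ`-smallness of the exceptional primes, the traces on closed totally disconnected
subgroups are locally essential. -/
theorem isLocallyEssential_comap_of_delta {G : AddSubgroup K} (hG : G.IsWeaklyEssential)
    (ho : G.PTorsionOpen)
    (hδ : ∀ M : AddSubgroup K, M.IsDeltaSubgroup → (M.torsionPrimes G).Finite)
    {L : Type*} [AddCommGroup L] [TopologicalSpace L] [IsTopologicalAddGroup L] [CompactSpace L]
    [TotallyDisconnectedSpace L] (f : L →+ K) (hf : Continuous f) (hi : Function.Injective f) :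
    (G.comap f).IsLocallyEssential := by
  have hemb : IsEmbedding f := (hf.isClosedEmbedding hi).isEmbedding
  have : T2Space L := hemb.t2Space
  -- The image of `L` need not be a `δ`-subgroup of `K`, but enlarging it only adds exceptional
  -- primes.
  obtain ⟨M, hM, hfM⟩ := exists_isDeltaSubgroup_ge f.range
    (by rw [AddMonoidHom.coe_range]; exact (isCompact_range hf).isClosed)
    (by
      rw [AddMonoidHom.coe_range]
      exact hemb.isTotallyDisconnected_range.2 inferInstance)
  refine isLocallyEssential_of_pTorsionOpen (isWeaklyEssential_comap f hf hi hG)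
    (pTorsionOpen_comap f hf ho) ((hδ M hM).subset fun p hp => ⟨hp.1, fun hle => hp.2 ?_⟩)
  intro x hx
  refine hle ⟨hfM ⟨x, rfl⟩, mem_torsionBy_iff.2 ?_⟩
  rw [← map_nsmul, mem_torsionBy_iff.1 hx.2, map_zero]

/-- Local essentiality in a `δ`-subgroup with finite-dimensional torus quotient implies local
essentiality. -/
theorem isLocallyEssential_of_delta {G : AddSubgroup K} (hG : G.IsWeaklyEssential)
    (hdim : FiniteCoveringDim (AddSubgroup.closedSocle K))
    {N : AddSubgroup (AddSubgroup.closedSocle K)} (hN : N.IsDeltaSubgroup)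
    (h : (G.comap ((AddSubgroup.closedSocle K).subtype.comp N.subtype)).IsLocallyEssential) :
    G.IsLocallyEssential := by
  obtain ⟨-, -, ι, ⟨e⟩⟩ := hN
  let q : AddSubgroup.closedSocle K →+ (ι → UnitAddCircle) :=
    e.toAddEquiv.toAddMonoidHom.comp (QuotientAddGroup.mk' N)
  have hqc : Continuous q := e.continuous.comp continuous_quotient_mk'
  have hqs : Function.Surjective q := e.surjective.comp (QuotientAddGroup.mk'_surjective N)
  have := finite_of_finiteCoveringDim hdim q hqc hqs
  obtain ⟨V', hV', hVG⟩ := IsLocallyEssential.exists_nhds h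
  rw [nhds_subtype_eq_comap, mem_comap] at hV'
  obtain ⟨V₁, hV₁, hV₁'⟩ := hV'
  rw [ZeroMemClass.coe_zero, nhds_subtype_eq_comap, mem_comap] at hV₁
  obtain ⟨V₂, hV₂, hV₂'⟩ := hV₁
  have hO : (⋂ i, {y | ‖q y i‖ < 1 / 4}) ∈ 𝓝 (0 : AddSubgroup.closedSocle K) := by
    refine (isOpen_iInter_of_finite fun i => ?_).mem_nhds (Set.mem_iInter.2 fun i => ?_)
    · exact isOpen_lt ((continuous_apply i).comp hqc).norm continuous_const
    · simp
  rw [nhds_subtype_eq_comap, mem_comap] at hO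
  obtain ⟨W, hW, hWO⟩ := hO
  refine isLocallyEssential_of_exists_nhds hG ⟨V₂ ∩ W, inter_mem hV₂ hW, fun p hp x hx hxV => ?_⟩
  let y : AddSubgroup.closedSocle K := ⟨x, mem_closedSocle hp hx⟩
  -- The cyclic subgroup of `y` has small image in a finite-dimensional torus, hence trivial image.
  have hyN : y ∈ N := by
    rw [← QuotientAddGroup.eq_zero_iff, ← map_eq_zero_iff e e.injective]
    change q y = 0
    funext i
    refine circle_eq_zero_of_multiples_small fun n => ?_
    have hn : n • y ∈ (Subtype.val ⁻¹' W : Set (AddSubgroup.closedSocle K)) :=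
      (hxV ⟨n, natCast_zsmul x n⟩).2
    have := Set.mem_iInter.1 (hWO hn) i
    rwa [Set.mem_ofPred_eq, map_nsmul] at this
  let z : N := ⟨y, hyN⟩
  refine hVG p hp z (Subtype.ext (Subtype.ext hx)) ?_
  rintro _ ⟨k, rfl⟩
  exact hV₁' (hV₂' (hxV ⟨k, rfl⟩).1)

end Main

end CompactAbelian

open CompactAbelian in
theorem mainTheorem9 {K : Type u} [AddCommGroup K] [TopologicalSpace K]
    [IsTopologicalAddGroup K] [CompactSpace K] [T2Space K]
    (G : AddSubgroup K) (hG : G.IsWeaklyEssential) :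
    (G.IsLocallyEssential →
      G.PTorsionOpen ∧
        ∃ n : ℕ, ∀ p : ℕ, p.Prime →
          pRank p (AddSubgroup.torsionBy K (p : ℤ) ⧸ G.pTorsionIn p) ≤ (n : Cardinal.{u})) ∧
    (G.PTorsionOpen → ((⊤ : AddSubgroup K).torsionPrimes G).Finite → G.IsLocallyEssential) ∧
    (FiniteCoveringDim (AddSubgroup.closedSocle K) →
      List.TFAE [
        G.IsLocallyEssential,
        G.PTorsionOpen ∧
          ∀ M : AddSubgroup K, M.IsDeltaSubgroup → (M.torsionPrimes G).Finite,
        ∃ N : AddSubgroup (AddSubgroup.closedSocle K), N.IsDeltaSubgroup ∧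
          ((G.addSubgroupOf (AddSubgroup.closedSocle K)).addSubgroupOf N).IsLocallyEssential,
        ∀ N : AddSubgroup (AddSubgroup.closedSocle K), N.IsDeltaSubgroup →
          ((G.addSubgroupOf (AddSubgroup.closedSocle K)).addSubgroupOf N).IsLocallyEssential]) ∧
    (TotallyDisconnectedSpace K →
      (G.IsLocallyEssential ↔
        ((⊤ : AddSubgroup K).torsionPrimes G).Finite ∧ G.PTorsionOpen)) := by
  refine ⟨IsLocallyEssential.pTorsionOpen_and_bounded, isLocallyEssential_of_pTorsionOpen hG,
    fun hdim => ?_, fun htd => ⟨fun h => ⟨?_, ?_⟩, fun h => ?_⟩⟩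
  · tfae_have 1 → 2 := fun h => ⟨(IsLocallyEssential.pTorsionOpen_and_bounded h).1, fun M hM =>
      IsLocallyEssential.finite_torsionPrimes h M hM.1 hM.2.1⟩
    tfae_have 2 → 4 := by
      rintro ⟨ho, hδ⟩ N ⟨hNc, hNd, -⟩
      have : CompactSpace N := isCompact_iff_compactSpace.1 hNc.isCompact
      have : TotallyDisconnectedSpace N := totallyDisconnectedSpace_subtype_iff.2 hNd
      exact isLocallyEssential_comap_of_delta hG ho hδ
        ((AddSubgroup.closedSocle K).subtype.comp N.subtype)
        (continuous_subtype_val.comp continuous_subtype_val)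
        (Subtype.val_injective.comp Subtype.val_injective)
    -- A `δ`-subgroup exists: take one above the trivial subgroup.
    tfae_have 4 → 3 := by
      intro h
      obtain ⟨N, hN, -⟩ := exists_isDeltaSubgroup_ge (⊥ : AddSubgroup (AddSubgroup.closedSocle K))
        isClosed_singleton isTotallyDisconnected_singleton
      exact ⟨N, hN, h N hN⟩
    tfae_have 3 → 1 := fun ⟨N, hN, h⟩ => isLocallyEssential_of_delta hG hdim hN h
    tfae_finish
  · exact IsLocallyEssential.finite_torsionPrimes h ⊤ isClosed_univ
      (isTotallyDisconnected_of_totallyDisconnectedSpace _)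
  · exact (IsLocallyEssential.pTorsionOpen_and_bounded h).1
  · exact isLocallyEssential_of_pTorsionOpen hG h.2 h.1
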